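/- **Setting.** Let $X$ be a compact smooth manifold, $H$ a Hilbert space, and $PU(H)=U(H)/U(1)$ its projective unitary group with the norm topology. Let $P\to X$ be a smooth principal $PU(H)$-bundle, $\mathcal L^1(P)=P\times_{PU(H)}\mathcal L^1(H)$ the associated bundle of algebras of trace class operators (adjoint action, trace norm), and, for $U\subseteq X$ open, let $C^\infty(U,\mathcal L^1(P))$ be the algebra of smooth sections over $U$ with pointwise product and the $C^\infty$ topology (uniform convergence of all derivatives on compact sets). Put $\mathcal A=C^\infty(X,\mathcal L^1(P))$. Let $\{U_i\}_{i\in I}$ be a good cover of $X$, i.e. an open cover all of whose non-empty finite intersections are contractible. For $p\ge 0$ let $\bigoplus_{i_0,\dots,i_p}\mathcal A_{i_0\cdots i_p}$ be the algebra of smooth sections of $\mathcal L^1(P)$ over the disjoint union $\bigsqcup_{(i_0,\dots,i_p)\in I^{p+1}}U_{i_0}\cap\cdots\cap U_{i_p}$ over **all** ordered tuples (that is, $\prod_{(i_0,\dots,i_p)}C^\infty(U_{i_0}\cap\cdots\cap U_{i_p},\mathcal L^1(P))$ with the product topology; the direct sum if $I$ is finite). **Chain complexes.** For a locally convex algebra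 $A$ with jointly continuous product let $A^{\hat\otimes n}$ be the completed $n$-fold projective tensor power, and put $CC_0(A)=A$ and $CC_k(A)=\tilde A\hat\otimes A^{\hat\otimes k}=A^{\hat\otimes (k+1)}\oplus A^{\hat\otimes k}$ for $k\ge1$, where $\tilde A=A\oplus\mathbb C$ is the unitalisation. Let $$b'(a_0\otimes\cdots\otimes a_n)=\sum_{j=0}^{n-1}(-1)^j a_0\otimes\cdots\otimes a_ja_{j+1}\otimes\cdots\otimes a_n,$$ $$b(a_0\otimes\cdots\otimes a_n)=b'(a_0\otimes\cdots\otimes a_n)+(-1)^n a_na_0\otimes a_1\otimes\cdots\otimes a_{n-1},$$ $$\lambda(a_0\otimes\cdots\otimes a_n)=(-1)^n a_n\otimes a_0\otimes\cdots\otimes a_{n-1},\qquad Q=\sum_{j=0}^{n}\lambda^j\ \text{ on } A^{\hat\otimes(n+1)}.$$ The Hochschild differential is $b(x,y)=(bx+(1-\lambda)y,\,-b'y)$ (only the first entry in degree $0$), and $B(x,y)=(0,Qx)$. With $u$ of degree $-2$, the cyclic complex $CC_\bullet(A)\otimes\mathbb C((u))/u\mathbb C[[u]]$ and the periodic complex $CC_\bullet(A)\otimes\mathbb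 C((u))$ consist in degree $m\in\mathbb Z$ of the formal sums $\sum_q c_{k,q}u^q$ with $c_{k,q}\in CC_k(A)$ and $k-2q=m$, with $q\le 0$ in the cyclic case and $q\in\mathbb Z$ arbitrary in the periodic case; the differential is $b+uB$. All these constructions are functorial for continuous algebra homomorphisms. **Čech maps.** Let $d_k:\bigoplus\mathcal A_{i_0\cdots i_p}\to\bigoplus\mathcal A_{i_0\cdots i_{p+1}}$, $0\le k\le p+1$, be the restriction homomorphisms $(d_ks)_{i_0\cdots i_{p+1}}=s_{i_0\cdots\widehat{i_k}\cdots i_{p+1}}|_{U_{i_0}\cap\cdots\cap U_{i_{p+1}}}$. Let $\delta=\sum_{k=0}^{p+1}(-1)^k (d_k)_*$, and let the first map $\delta$, on the complex of $\mathcal A$, be induced by restriction $\mathcal A\to\bigoplus_i\mathcal A_i$. **Proposition.** The sequences $$0\to CC_\bullet(\mathcal A)\xrightarrow{\delta}CC_\bullet\Big(\bigoplus_i\mathcal A_i\Big)\xrightarrow{\delta}CC_\bullet\Big(\bigoplus_{i,j}\mathcal A_{ij}\Big)\xrightarrow{\delta}\cdots$$ $$0\to CC_\bullet(\mathcal A)\otimes\tfrac{\mathbb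 C((u))}{u\mathbb C[[u]]}\xrightarrow{\delta}CC_\bullet\Big(\bigoplus_i\mathcal A_i\Big)\otimes\tfrac{\mathbb C((u))}{u\mathbb C[[u]]}\xrightarrow{\delta}CC_\bullet\Big(\bigoplus_{i,j}\mathcal A_{ij}\Big)\otimes\tfrac{\mathbb C((u))}{u\mathbb C[[u]]}\xrightarrow{\delta}\cdots$$ $$0\to CC_\bullet(\mathcal A)\otimes\mathbb C((u))\xrightarrow{\delta}CC_\bullet\Big(\bigoplus_i\mathcal A_i\Big)\otimes\mathbb C((u))\xrightarrow{\delta}CC_\bullet\Big(\bigoplus_{i,j}\mathcal A_{ij}\Big)\otimes\mathbb C((u))\xrightarrow{\delta}\cdots$$ are exact sequences of complexes: every term is a chain complex (differential $b$ in the first sequence, $b+uB$ in the other two), every map $\delta$ is a chain map, and the sequences of vector spaces are exact in every degree. -/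

import Mathlib

open scoped ContDiff Manifold Topology ENNReal NNReal InnerProductSpace TensorProduct

noncomputable section

namespace CechCyclic

/-! ### Trace class operators -/

section TraceClass

variable {H : Type*} [NormedAddCommGroup H] [InnerProductSpace ℂ H] [CompleteSpace H]

theorem enorm_le_one_of {V : Type*} [SeminormedAddCommGroup V] {z : V} (hz : ‖z‖ ≤ 1) :
    ‖z‖ₑ ≤ 1 := by
  rw [← ofReal_norm]; exact ENNReal.ofReal_le_one.2 hz

variable (H) in
/-- Index set of a chosen orthonormal (Hilbert) basis of `H`. -/
def onbIndex : Set H := (exists_hilbertBasis ℂ H).choose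

variable (H) in
/-- A chosen orthonormal (Hilbert) basis of `H`. -/
def onb : HilbertBasis (onbIndex H) ℂ H := (exists_hilbertBasis ℂ H).choose_spec.choose

/-- `tr |x| = ∑ ⟪v, |x| v⟫` over an orthonormal basis, where `|x| = √(x* x)`, as an extended
nonnegative real. -/
def traceNorm (x : H →L[ℂ] H) : ℝ≥0∞ :=
  ∑' i, ENNReal.ofReal (⟪onb H i, CFC.abs x (onb H i)⟫_ℂ).re

/-- The square of the Hilbert–Schmidt norm. -/
def hsSq (x : H →L[ℂ] H) : ℝ≥0∞ := ∑' i, ‖x (onb H i)‖ₑ ^ 2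

theorem tsum_enorm_inner_sq (v : H) : ∑' i, ‖⟪onb H i, v⟫_ℂ‖ₑ ^ 2 = ‖v‖ₑ ^ 2 := by
  have h := (onb H).hasSum_inner_mul_inner v v
  have h2 : HasSum (fun i => ‖⟪onb H i, v⟫_ℂ‖ ^ 2) (‖v‖ ^ 2) := by
    have := Complex.hasSum_re h
    convert! this using 1
    · ext i
      rw [← inner_conj_symm v, mul_comm, RCLike.mul_conj]
      norm_cast
    · rw [inner_self_eq_norm_sq_to_K]; norm_cast
  have h3 := ENNReal.ofReal_tsum_of_nonneg (fun i => sq_nonneg ‖⟪onb H i, v⟫_ℂ‖) h2.summable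
  rw [h2.tsum_eq] at h3
  simp only [ENNReal.ofReal_pow (norm_nonneg _), ofReal_norm] at h3
  exact h3.symm

theorem hsSq_star (x : H →L[ℂ] H) : hsSq (star x) = hsSq x := by
  have h : ∀ y : H →L[ℂ] H, hsSq y = ∑' i, ∑' j, ‖⟪onb H j, y (onb H i)⟫_ℂ‖ₑ ^ 2 := fun y =>
    tsum_congr fun i => (tsum_enorm_inner_sq _).symm
  rw [h, h, ENNReal.tsum_comm]
  refine tsum_congr fun i => tsum_congr fun j => ?_
  rw [ContinuousLinearMap.star_eq_adjoint, ContinuousLinearMap.adjoint_inner_right,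
    ← inner_conj_symm, enorm_eq_nnnorm, enorm_eq_nnnorm, RCLike.nnnorm_conj]

theorem hsSq_mul_le (a x : H →L[ℂ] H) : hsSq (a * x) ≤ ‖a‖ₑ ^ 2 * hsSq x := by
  unfold hsSq
  rw [← ENNReal.tsum_mul_left]
  refine ENNReal.tsum_le_tsum fun i => ?_
  rw [← mul_pow]
  gcongr
  exact a.le_opENorm _

theorem hsSq_mul_le' (x a : H →L[ℂ] H) : hsSq (x * a) ≤ ‖a‖ₑ ^ 2 * hsSq x := by
  rw [← hsSq_star, star_mul, ← hsSq_star x]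
  refine (hsSq_mul_le _ _).trans_eq ?_
  rw [enorm_eq_nnnorm, enorm_eq_nnnorm, nnnorm_star]

/-- The square root of `|x|`. -/
def rootAbs (x : H →L[ℂ] H) : H →L[ℂ] H := CFC.sqrt (CFC.abs x)

theorem rootAbs_star (x : H →L[ℂ] H) : star (rootAbs x) = rootAbs x :=
  (CFC.sqrt_nonneg (CFC.abs x)).isSelfAdjoint

theorem rootAbs_mul_self (x : H →L[ℂ] H) : rootAbs x * rootAbs x = CFC.abs x :=
  CFC.sqrt_mul_sqrt_self _ (CFC.abs_nonneg x)

theorem inner_abs (x : H →L[ℂ] H) (v w : H) :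
    ⟪v, CFC.abs x w⟫_ℂ = ⟪rootAbs x v, rootAbs x w⟫_ℂ := by
  rw [← rootAbs_mul_self, mul_apply_eq_comp,
    ← ContinuousLinearMap.adjoint_inner_left, ← ContinuousLinearMap.star_eq_adjoint, rootAbs_star]

theorem traceNorm_eq_hsSq (x : H →L[ℂ] H) : traceNorm x = hsSq (rootAbs x) := by
  refine tsum_congr fun i => ?_
  rw [inner_abs, inner_self_eq_norm_sq_to_K, ← ofReal_norm, ← ENNReal.ofReal_pow (norm_nonneg _)]
  norm_cast

theorem norm_abs_apply (x : H →L[ℂ] H) (v : H) : ‖CFC.abs x v‖ = ‖x v‖ := by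
  have h : ⟪CFC.abs x v, CFC.abs x v⟫_ℂ = ⟪x v, x v⟫_ℂ := by
    have hs : star (CFC.abs x) = CFC.abs x := (CFC.abs_nonneg x).isSelfAdjoint
    rw [← ContinuousLinearMap.adjoint_inner_right, ← ContinuousLinearMap.adjoint_inner_right,
      ← ContinuousLinearMap.star_eq_adjoint, ← ContinuousLinearMap.star_eq_adjoint, hs,
      ← mul_apply_eq_comp, CFC.abs_mul_abs, mul_apply_eq_comp]
  rw [inner_self_eq_norm_sq_to_K, inner_self_eq_norm_sq_to_K] at h
  have h' : ‖CFC.abs x v‖ ^ 2 = ‖x v‖ ^ 2 := by exact_mod_cast h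
  exact (pow_left_inj₀ (norm_nonneg _) (norm_nonneg _) two_ne_zero).1 h'

/-- Polar decomposition. -/
theorem exists_polar (x : H →L[ℂ] H) :
    ∃ w : H →L[ℂ] H, ‖w‖ ≤ 1 ∧ w * CFC.abs x = x ∧ star w * x = CFC.abs x := by
  set a := CFC.abs x with ha
  let K : Submodule ℂ H := (LinearMap.range a.toLinearMap).topologicalClosure
  have : CompleteSpace K :=
    (Submodule.isClosed_topologicalClosure (LinearMap.range a.toLinearMap)).completeSpace_coe
  have hmem : ∀ v, a v ∈ K := fun v => Submodule.le_topologicalClosure _ ⟨v, rfl⟩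
  let e : H →ₗ[ℂ] K := a.toLinearMap.codRestrict K hmem
  have hd : DenseRange e := by
    intro k
    rw [Metric.mem_closure_iff]
    intro ε hε
    obtain ⟨_, ⟨v, rfl⟩, hv⟩ := Metric.mem_closure_iff.1 k.2 ε hε
    exact ⟨e v, ⟨v, rfl⟩, hv⟩
  have hb : ∀ v, ‖x.toLinearMap v‖ ≤ 1 * ‖e v‖ := fun v => by
    rw [one_mul]; exact (norm_abs_apply x v).symm.le
  let w : H →L[ℂ] H := (x.toLinearMap.extendOfNorm e) ∘L K.orthogonalProjectionOnto
  have hw : ‖w‖ ≤ 1 := by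
    refine (ContinuousLinearMap.opNorm_comp_le _ _).trans ?_
    refine mul_le_one₀ ?_ (norm_nonneg _) (Submodule.orthogonalProjectionOnto_norm_le K)
    exact LinearMap.opNorm_extendOfNorm_le hd zero_le_one hb
  have hwa : w * a = x := by
    ext v
    have : K.orthogonalProjectionOnto (a v) = e v :=
      Submodule.orthogonalProjectionOnto_mem_subspace_eq_self (e v)
    change x.toLinearMap.extendOfNorm e (K.orthogonalProjectionOnto (a v)) = x v
    rw [this, LinearMap.extendOfNorm_eq hd ⟨1, hb⟩]; rfl
  refine ⟨w, hw, hwa, ?_⟩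
  ext v
  rw [← sub_eq_zero, ← norm_le_zero_iff]
  set y := (star w * x) v with hy
  have hx : x v = w (a v) := by rw [← mul_apply_eq_comp, hwa]
  have h1 : ‖y‖ ≤ ‖a v‖ := by
    rw [hy, mul_apply_eq_comp, norm_abs_apply]
    refine ((star w).le_opNorm _).trans ?_
    rw [norm_star]
    exact mul_le_of_le_one_left (norm_nonneg _) hw
  have h2 : ⟪y, a v⟫_ℂ = (‖a v‖ : ℂ) ^ 2 := by
    rw [hy, mul_apply_eq_comp, ContinuousLinearMap.star_eq_adjoint,
      ContinuousLinearMap.adjoint_inner_left, ← hx, inner_self_eq_norm_sq_to_K, norm_abs_apply]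
    norm_cast
  have h3 : ‖y - a v‖ ^ 2 ≤ 0 := by
    rw [@norm_sub_sq ℂ, h2]
    have : RCLike.re ((‖a v‖ : ℂ) ^ 2) = ‖a v‖ ^ 2 := by norm_cast
    rw [this]
    nlinarith [norm_nonneg y, norm_nonneg (a v)]
  nlinarith [norm_nonneg (y - a v)]

theorem enorm_sum_inner_le (x z : H →L[ℂ] H) (F : Finset (onbIndex H)) :
    ‖∑ i ∈ F, ⟪z (onb H i), x (onb H i)⟫_ℂ‖ₑ ≤ ‖z‖ₑ * traceNorm x := by
  obtain ⟨w, hw, hwx, -⟩ := exists_polar x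
  set s := rootAbs x
  set t := s * (star w * z)
  have key : ∀ i, ⟪z (onb H i), x (onb H i)⟫_ℂ = ⟪t (onb H i), s (onb H i)⟫_ℂ := by
    intro i
    conv_lhs => rw [← hwx]
    rw [mul_apply_eq_comp, ← ContinuousLinearMap.adjoint_inner_left, inner_abs]
    rfl
  have ht : hsSq t ≤ ‖z‖ₑ ^ 2 * traceNorm x := by
    rw [traceNorm_eq_hsSq]
    refine (hsSq_mul_le' _ _).trans ?_
    gcongr
    have : ‖star w * z‖ ≤ ‖z‖ := by
      refine (norm_mul_le _ _).trans ?_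
      rw [norm_star]
      exact mul_le_of_le_one_left (norm_nonneg _) hw
    exact enorm_le_iff_norm_le.2 this
  have cs : ∑ i ∈ F, ‖t (onb H i)‖ₑ * ‖s (onb H i)‖ₑ ≤ ‖z‖ₑ * traceNorm x := by
    refine (ENNReal.inner_le_Lp_mul_Lq F _ _ Real.HolderConjugate.two_two).trans ?_
    have h1 : (∑ i ∈ F, ‖t (onb H i)‖ₑ ^ (2 : ℝ)) ≤ ‖z‖ₑ ^ (2 : ℝ) * traceNorm x := by
      simp only [ENNReal.rpow_two]
      exact (ENNReal.sum_le_tsum F).trans ht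
    have h2 : (∑ i ∈ F, ‖s (onb H i)‖ₑ ^ (2 : ℝ)) ≤ traceNorm x := by
      simp only [ENNReal.rpow_two]
      rw [traceNorm_eq_hsSq]
      exact ENNReal.sum_le_tsum F
    refine (mul_le_mul' (ENNReal.rpow_le_rpow h1 (by norm_num))
      (ENNReal.rpow_le_rpow h2 (by norm_num))).trans_eq ?_
    rw [ENNReal.mul_rpow_of_nonneg _ _ (by norm_num), ← ENNReal.rpow_mul, mul_assoc,
      ← ENNReal.rpow_add_of_nonneg _ _ (by norm_num) (by norm_num)]
    norm_num
  calc ‖∑ i ∈ F, ⟪z (onb H i), x (onb H i)⟫_ℂ‖ₑ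
      ≤ ∑ i ∈ F, ‖⟪z (onb H i), x (onb H i)⟫_ℂ‖ₑ := enorm_sum_le _ _
    _ ≤ ∑ i ∈ F, ‖t (onb H i)‖ₑ * ‖s (onb H i)‖ₑ := by
        refine Finset.sum_le_sum fun i _ => ?_
        rw [key]
        simp only [← ofReal_norm, ← ENNReal.ofReal_mul (norm_nonneg _)]
        exact ENNReal.ofReal_le_ofReal (norm_inner_le_norm _ _)
    _ ≤ _ := cs

theorem traceNorm_le_of_forall (x : H →L[ℂ] H) (M : ℝ≥0∞)
    (h : ∀ (z : H →L[ℂ] H) (F : Finset (onbIndex H)), ‖z‖ ≤ 1 →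
      ‖∑ i ∈ F, ⟪z (onb H i), x (onb H i)⟫_ℂ‖ₑ ≤ M) : traceNorm x ≤ M := by
  obtain ⟨w, hw, -, hwx⟩ := exists_polar x
  unfold traceNorm
  rw [ENNReal.tsum_eq_iSup_sum]
  refine iSup_le fun F => ?_
  refine le_trans ?_ (h w F hw)
  have hpos : ∀ i, 0 ≤ (⟪onb H i, CFC.abs x (onb H i)⟫_ℂ).re := fun i => by
    rw [inner_abs, inner_self_eq_norm_sq_to_K]
    exact_mod_cast sq_nonneg ‖rootAbs x (onb H i)‖
  rw [← ENNReal.ofReal_sum_of_nonneg fun i _ => hpos i, ← ofReal_norm]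
  refine ENNReal.ofReal_le_ofReal ?_
  rw [← Complex.re_sum]
  refine (Complex.re_le_norm _).trans_eq ?_
  congr 1
  refine Finset.sum_congr rfl fun i _ => ?_
  rw [← hwx, mul_apply_eq_comp, ContinuousLinearMap.star_eq_adjoint,
    ContinuousLinearMap.adjoint_inner_right]

theorem traceNorm_add_le (x y : H →L[ℂ] H) :
    traceNorm (x + y) ≤ traceNorm x + traceNorm y := by
  refine traceNorm_le_of_forall _ _ fun z F hz => ?_
  simp only [add_apply, inner_add_right, Finset.sum_add_distrib]
  refine (enorm_add_le _ _).trans (add_le_add ?_ ?_) <;>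
  · refine (enorm_sum_inner_le _ z F).trans ?_
    exact mul_le_of_le_one_left' (enorm_le_one_of hz)

theorem traceNorm_mul_le (a x : H →L[ℂ] H) : traceNorm (a * x) ≤ ‖a‖ₑ * traceNorm x := by
  refine traceNorm_le_of_forall _ _ fun z F hz => ?_
  have : ∀ i, ⟪z (onb H i), (a * x) (onb H i)⟫_ℂ = ⟪(star a * z) (onb H i), x (onb H i)⟫_ℂ :=
    fun i => by
      rw [mul_apply_eq_comp, ← ContinuousLinearMap.adjoint_inner_left]; rfl
  simp only [this]
  refine (enorm_sum_inner_le _ _ F).trans ?_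
  gcongr
  refine enorm_le_iff_norm_le.2 ((norm_mul_le _ _).trans ?_)
  rw [norm_star]
  exact mul_le_of_le_one_right (norm_nonneg _) hz

theorem traceNorm_smul (c : ℂ) (x : H →L[ℂ] H) : traceNorm (c • x) = ‖c‖ₑ * traceNorm x := by
  unfold traceNorm
  rw [CFC.abs_smul, ← ENNReal.tsum_mul_left]
  refine tsum_congr fun i => ?_
  rw [← ofReal_norm, ← ENNReal.ofReal_mul (norm_nonneg _)]
  congr 1
  simp

theorem traceNorm_zero : traceNorm (0 : H →L[ℂ] H) = 0 := by simp [traceNorm]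

theorem enorm_le_traceNorm (x : H →L[ℂ] H) : ‖x‖ₑ ≤ traceNorm x := by
  have hs : ∀ v, ‖rootAbs x v‖ₑ ^ 2 ≤ traceNorm x * ‖v‖ₑ ^ 2 := fun v => by
    rw [← tsum_enorm_inner_sq, traceNorm_eq_hsSq, hsSq, ← ENNReal.tsum_mul_right]
    refine ENNReal.tsum_le_tsum fun i => ?_
    rw [← mul_pow]
    gcongr
    rw [← ContinuousLinearMap.adjoint_inner_left, ← ContinuousLinearMap.star_eq_adjoint,
      rootAbs_star]
    simp only [← ofReal_norm, ← ENNReal.ofReal_mul (norm_nonneg _)]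
    exact ENNReal.ofReal_le_ofReal (norm_inner_le_norm _ _)
  by_cases hx : traceNorm x = ⊤
  · simp [hx]
  set r := (traceNorm x).toReal with hr
  have hr0 : 0 ≤ r := ENNReal.toReal_nonneg
  have hrx : traceNorm x = ENNReal.ofReal r := (ENNReal.ofReal_toReal hx).symm
  have hs' : ∀ v, ‖rootAbs x v‖ ^ 2 ≤ r * ‖v‖ ^ 2 := fun v => by
    have := hs v
    rw [hrx, ← ofReal_norm, ← ofReal_norm, ← ENNReal.ofReal_pow (norm_nonneg _),
      ← ENNReal.ofReal_pow (norm_nonneg _), ← ENNReal.ofReal_mul hr0] at this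
    exact (ENNReal.ofReal_le_ofReal_iff (by positivity)).1 this
  rw [hrx, ← ofReal_norm]
  refine ENNReal.ofReal_le_ofReal (x.opNorm_le_bound hr0 fun v => ?_)
  rw [← norm_abs_apply, ← rootAbs_mul_self, mul_apply_eq_comp]
  have h1 := hs' (rootAbs x v)
  have h2 := hs' v
  refine abs_le_of_sq_le_sq' ?_ (by positivity) |>.2
  calc _ ≤ r * ‖rootAbs x v‖ ^ 2 := h1
    _ ≤ r * (r * ‖v‖ ^ 2) := by gcongr
    _ = _ := by ring

theorem traceNorm_unitary_conj (u : unitary (H →L[ℂ] H)) (x : H →L[ℂ] H) :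
    traceNorm ((u : H →L[ℂ] H) * x * star (u : H →L[ℂ] H)) ≤ traceNorm x := by
  have huu : star (u : H →L[ℂ] H) * (u : H →L[ℂ] H) = 1 := Unitary.coe_star_mul_self u
  have hnorm : ‖(u : H →L[ℂ] H)‖ₑ ≤ 1 := by
    refine enorm_le_one_of (ContinuousLinearMap.opNorm_le_bound _ zero_le_one fun v => ?_)
    rw [one_mul]
    have h : ‖(u : H →L[ℂ] H) v‖ ^ 2 = ‖v‖ ^ 2 := by
      have h1 : ⟪(u : H →L[ℂ] H) v, (u : H →L[ℂ] H) v⟫_ℂ = ⟪v, v⟫_ℂ := by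
        rw [← ContinuousLinearMap.adjoint_inner_right, ← ContinuousLinearMap.star_eq_adjoint,
          ← mul_apply_eq_comp, huu]; rfl
      rw [inner_self_eq_norm_sq_to_K, inner_self_eq_norm_sq_to_K] at h1
      exact_mod_cast h1
    exact ((pow_left_inj₀ (norm_nonneg _) (norm_nonneg _) two_ne_zero).1 h).le
  have hsqrt : ∀ y : H →L[ℂ] H, 0 ≤ y →
      CFC.sqrt ((u : H →L[ℂ] H) * y * star (u : H →L[ℂ] H)) =
        (u : H →L[ℂ] H) * CFC.sqrt y * star (u : H →L[ℂ] H) := fun y hy => by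
    rw [CFC.sqrt_eq_iff _ _ (star_right_conjugate_nonneg hy _)
      (star_right_conjugate_nonneg (CFC.sqrt_nonneg y) _)]
    calc _ = (u : H →L[ℂ] H) * CFC.sqrt y * (star (u : H →L[ℂ] H) * (u : H →L[ℂ] H))
          * CFC.sqrt y * star (u : H →L[ℂ] H) := by simp only [mul_assoc]
      _ = (u : H →L[ℂ] H) * (CFC.sqrt y * CFC.sqrt y) * star (u : H →L[ℂ] H) := by
          rw [huu]; simp only [mul_assoc, one_mul]
      _ = _ := by rw [CFC.sqrt_mul_sqrt_self y hy]
  have habs : CFC.abs ((u : H →L[ℂ] H) * x * star (u : H →L[ℂ] H)) =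
      (u : H →L[ℂ] H) * CFC.abs x * star (u : H →L[ℂ] H) := by
    rw [CFC.abs, CFC.abs, ← hsqrt _ (star_mul_self_nonneg x)]
    congr 1
    calc _ = (u : H →L[ℂ] H) * star x * (star (u : H →L[ℂ] H) * (u : H →L[ℂ] H)) * x
          * star (u : H →L[ℂ] H) := by simp only [star_mul, star_star, mul_assoc]
      _ = _ := by rw [huu]; simp only [mul_assoc, one_mul]
  rw [traceNorm_eq_hsSq, traceNorm_eq_hsSq, rootAbs, habs, hsqrt _ (CFC.abs_nonneg x)]
  refine (hsSq_mul_le' _ _).trans ?_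
  have h1 : ‖star (u : H →L[ℂ] H)‖ₑ ≤ 1 := by
    rw [← ofReal_norm, norm_star, ofReal_norm]; exact hnorm
  refine (mul_le_of_le_one_left' (pow_le_one₀ (zero_le) h1)).trans ?_
  refine (hsSq_mul_le _ _).trans ?_
  exact mul_le_of_le_one_left' (pow_le_one₀ (zero_le) hnorm)

variable (H) in
/-- The trace class operators `x` on `H` (those with `tr |x| < ∞`), as a subalgebra of `B(H)`. -/
def traceClassAlgebra : NonUnitalSubalgebra ℂ (H →L[ℂ] H) where
  carrier := {x | traceNorm x < ⊤}
  add_mem' hx hy := (traceNorm_add_le _ _).trans_lt (ENNReal.add_lt_top.2 ⟨hx, hy⟩)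
  zero_mem' := by simp [traceNorm_zero]
  mul_mem' {a b} _ hy :=
    (traceNorm_mul_le a b).trans_lt (ENNReal.mul_lt_top enorm_lt_top hy)
  smul_mem' c x hx := by
    change traceNorm (c • x) < ⊤
    rw [traceNorm_smul]
    exact ENNReal.mul_lt_top enorm_lt_top hx

variable (H) in
/-- The Banach algebra `L¹(H)` of trace class operators, with the trace norm. -/
def TraceClass : Type _ := traceClassAlgebra H

namespace TraceClass

/-- The ring structure on trace class operators. -/
abbrev ringAux : NonUnitalRing (TraceClass H) :=
  inferInstanceAs (NonUnitalRing (traceClassAlgebra H))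

section

attribute [local instance] ringAux

/-- The complex vector space structure on trace class operators. -/
abbrev moduleAux : Module ℂ (TraceClass H) := inferInstanceAs (Module ℂ (traceClassAlgebra H))

attribute [local instance] moduleAux

/-- The underlying bounded operator. -/
def val (x : TraceClass H) : H →L[ℂ] H := Subtype.val x

theorem val_injective : Function.Injective (val : TraceClass H → H →L[ℂ] H) :=
  Subtype.val_injective

theorem lt_top (x : TraceClass H) : traceNorm x.val < ⊤ := Subtype.property x

/-- The trace norm `‖x‖₁ = tr |x|`. -/
instance : Norm (TraceClass H) := ⟨fun x => (traceNorm x.val).toReal⟩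

theorem norm_def (x : TraceClass H) : ‖x‖ = (traceNorm x.val).toReal := rfl

/-- The normed group of trace class operators. -/
abbrev normedAux : NormedAddCommGroup (TraceClass H) :=
  NormedAddCommGroup.ofCore (𝕜 := ℂ)
    { norm_nonneg := fun _ => ENNReal.toReal_nonneg
      norm_smul := fun c x => by
        have : (c • x).val = c • x.val := rfl
        simp [norm_def, this, traceNorm_smul]
      norm_triangle := fun x y => by
        rw [norm_def, norm_def, norm_def,
          ← ENNReal.toReal_add x.lt_top.ne y.lt_top.ne]
        exact ENNReal.toReal_mono (ENNReal.add_lt_top.2 ⟨x.lt_top, y.lt_top⟩).ne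
          (traceNorm_add_le _ _)
      norm_eq_zero_iff := fun x => by
        constructor
        · intro h
          rcases (ENNReal.toReal_eq_zero_iff _).1 h with h | h
          · apply val_injective
            have := (enorm_le_traceNorm x.val).trans_eq h
            exact enorm_eq_zero.1 (le_antisymm this (zero_le))
          · exact absurd h x.lt_top.ne
        · rintro rfl
          have : (0 : TraceClass H).val = 0 := rfl
          simp [norm_def, this, traceNorm_zero] }

theorem norm_val_le (x : TraceClass H) : ‖x.val‖ ≤ ‖x‖ := by
  have := ENNReal.toReal_mono x.lt_top.ne (enorm_le_traceNorm x.val)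
  rwa [toReal_enorm] at this

instance : NonUnitalNormedRing (TraceClass H) where
  __ := normedAux (H := H)
  __ := ringAux (H := H)
  dist_eq := dist_eq_norm_neg_add
  norm_mul_le x y := by
    have h : (x * y).val = x.val * y.val := rfl
    have h1 := ENNReal.toReal_mono (ENNReal.mul_lt_top enorm_lt_top y.lt_top).ne
      (traceNorm_mul_le x.val y.val)
    rw [ENNReal.toReal_mul, toReal_enorm] at h1
    rw [norm_def, h]
    refine h1.trans ?_
    exact mul_le_mul_of_nonneg_right (norm_val_le x) ENNReal.toReal_nonneg

end

instance : NormedSpace ℂ (TraceClass H) where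
  __ := moduleAux (H := H)
  norm_smul_le c x := by
    have : (c • x).val = c • x.val := rfl
    simp [norm_def, this, traceNorm_smul]

instance : IsScalarTower ℂ (TraceClass H) (TraceClass H) :=
  inferInstanceAs (IsScalarTower ℂ (traceClassAlgebra H) (traceClassAlgebra H))
instance : SMulCommClass ℂ (TraceClass H) (TraceClass H) :=
  inferInstanceAs (SMulCommClass ℂ (traceClassAlgebra H) (traceClassAlgebra H))

/-- Conjugation of trace class operators by a unitary, `x ↦ u x u*`. -/
def conj (u : unitary (H →L[ℂ] H)) : TraceClass H →L[ℂ] TraceClass H :=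
  LinearMap.mkContinuous
    { toFun := fun x => ⟨(u : H →L[ℂ] H) * x.val * star (u : H →L[ℂ] H),
        (traceNorm_unitary_conj u x.val).trans_lt x.lt_top⟩
      map_add' := fun x y => val_injective (by
        change (u : H →L[ℂ] H) * (x.val + y.val) * star (u : H →L[ℂ] H) =
          (u : H →L[ℂ] H) * x.val * star (u : H →L[ℂ] H) +
            (u : H →L[ℂ] H) * y.val * star (u : H →L[ℂ] H)
        rw [mul_add, add_mul])
      map_smul' := fun c x => val_injective (by
        change (u : H →L[ℂ] H) * (c • x.val) * star (u : H →L[ℂ] H) =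
          c • ((u : H →L[ℂ] H) * x.val * star (u : H →L[ℂ] H))
        rw [mul_smul_comm, smul_mul_assoc]) } 1 (fun x => by
    rw [one_mul]
    exact ENNReal.toReal_mono x.lt_top.ne (traceNorm_unitary_conj u x.val))

theorem val_conj (u : unitary (H →L[ℂ] H)) (x : TraceClass H) :
    (conj u x).val = (u : H →L[ℂ] H) * x.val * star (u : H →L[ℂ] H) := rfl

theorem conj_mul (u : unitary (H →L[ℂ] H)) (x y : TraceClass H) :
    conj u (x * y) = conj u x * conj u y := by
  apply val_injective
  have h : ∀ a b : TraceClass H, (a * b).val = a.val * b.val := fun _ _ => rfl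
  rw [val_conj, h, h, val_conj, val_conj]
  calc _ = (u : H →L[ℂ] H) * x.val * 1 * y.val * star (u : H →L[ℂ] H) := by
        simp only [mul_assoc, one_mul]
    _ = _ := by rw [← Unitary.coe_star_mul_self u]; simp only [mul_assoc]

end TraceClass

end TraceClass

/-! ### The projective unitary group -/

section ProjectiveUnitary

variable (H : Type*) [NormedAddCommGroup H] [InnerProductSpace ℂ H] [CompleteSpace H]

/-- The subgroup `U(1)` of scalar unitary operators. -/
def scalarUnitary : Subgroup (unitary (H →L[ℂ] H)) where
  carrier := {u | ∃ z : unitary ℂ, (u : H →L[ℂ] H) = (z : ℂ) • (1 : H →L[ℂ] H)}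
  mul_mem' := by
    rintro u v ⟨z, hz⟩ ⟨w, hw⟩
    exact ⟨z * w, by
      change (u : H →L[ℂ] H) * (v : H →L[ℂ] H) = _
      rw [hz, hw, smul_mul_assoc, one_mul, smul_smul]; rfl⟩
  one_mem' := ⟨1, by simp⟩
  inv_mem' := by
    rintro u ⟨z, hz⟩
    refine ⟨star z, ?_⟩
    change star (u : H →L[ℂ] H) = _
    rw [hz, star_smul, star_one]; rfl

instance : (scalarUnitary H).Normal where
  conj_mem := by
    rintro u ⟨z, hz⟩ v
    refine ⟨z, ?_⟩
    change (v : H →L[ℂ] H) * u * star (v : H →L[ℂ] H) = _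
    rw [hz, mul_smul_comm, smul_mul_assoc, mul_one, Unitary.mul_star_self_of_mem v.2]

/-- The projective unitary group `PU(H) = U(H) / U(1)`. -/
abbrev PU : Type _ := unitary (H →L[ℂ] H) ⧸ scalarUnitary H

variable {H} in
/-- The adjoint action of `PU(H)` on `L¹(H)`: the class of `u` acts by `x ↦ u x u*`. -/
def Ad : PU H →* (TraceClass H →L[ℂ] TraceClass H) :=
  QuotientGroup.lift (scalarUnitary H)
    { toFun := TraceClass.conj
      map_one' := by
        ext x; apply TraceClass.val_injective; simp [TraceClass.val_conj]
      map_mul' := fun u v => by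
        ext x; apply TraceClass.val_injective
        simp [TraceClass.val_conj, mul_apply_eq_comp, mul_assoc] }
    (by
      rintro u ⟨z, hz⟩
      ext x; apply TraceClass.val_injective
      change (TraceClass.conj u x).val = x.val
      have hzz : (z : ℂ) * star (z : ℂ) = 1 := Unitary.coe_mul_star_self z
      rw [TraceClass.val_conj, hz, star_smul, star_one, smul_mul_assoc, one_mul,
        smul_mul_assoc, mul_smul_comm, mul_one, smul_smul, hzz, one_smul])

variable {H}

theorem Ad_mk (u : unitary (H →L[ℂ] H)) (x : TraceClass H) :
    Ad (QuotientGroup.mk u : PU H) x = TraceClass.conj u x := rfl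

theorem Ad_mul (g : PU H) (x y : TraceClass H) : Ad g (x * y) = Ad g x * Ad g y := by
  induction g using QuotientGroup.induction_on with
  | H u => simp only [Ad_mk, TraceClass.conj_mul]

end ProjectiveUnitary

/-! ### Principal `PU(H)`-bundles and the algebra of smooth sections of `L¹(P)` -/

section Bundle

universe v

variable (E H X : Type*) [NormedAddCommGroup E] [NormedSpace ℝ E]
  [NormedAddCommGroup H] [InnerProductSpace ℂ H] [CompleteSpace H]
  [TopologicalSpace X] [ChartedSpace E X]

variable {H X} in
/-- Smoothness on an open set `S` of a map into the Banach Lie group `PU(H) = U(H) / U(1)` (norm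
topology): locally the map lifts to a map into `U(H)` which is smooth as a map into `B(H)`. (The
projection `U(H) → PU(H)` has smooth local sections.) -/
def SmoothPUOn (g : X → PU H) (S : Set X) : Prop :=
  ∀ x ∈ S, ∃ W ∈ 𝓝 x, ∃ u : X → unitary (H →L[ℂ] H),
    ContMDiffOn 𝓘(ℝ, E) 𝓘(ℝ, H →L[ℂ] H) ∞ (fun y => (u y : H →L[ℂ] H)) W ∧
      ∀ y ∈ W ∩ S, g y = QuotientGroup.mk (u y)

/-- A smooth principal `PU(H)`-bundle `P → X`: a right `PU(H)`-space `Total` over `X` whose fibres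
are torsors, with local sections `sec i` over the members `base i` of an open cover of `X`, related
by smooth transition functions, `sec j = sec i · g i j`. (The values of `sec i` outside `base i`
and of `trans i j` outside `base i ∩ base j` are irrelevant.) -/
structure PrincipalPUBundle where
  /-- the total space -/
  Total : Type v
  /-- the right action of the structure group -/
  [action : MulAction (PU H)ᵐᵒᵖ Total]
  /-- the bundle projection -/
  proj : Total → X
  proj_smul : ∀ (g : PU H) (p : Total), proj (MulOpposite.op g • p) = proj p
  torsor : ∀ p q : Total, proj p = proj q → ∃! g : PU H, MulOpposite.op g • p = q
  /-- index set of the local trivialisations -/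
  Index : Type v
  /-- the domains of the local trivialisations -/
  base : Index → TopologicalSpace.Opens X
  cover : ∀ x, ∃ i, x ∈ base i
  /-- the local sections -/
  sec : Index → X → Total
  proj_sec : ∀ i, ∀ x ∈ base i, proj (sec i x) = x
  /-- the transition functions -/
  trans : Index → Index → X → PU H
  sec_trans : ∀ i j, ∀ x ∈ base i ⊓ base j,
    sec j x = MulOpposite.op (trans i j x) • sec i x
  smooth_trans : ∀ i j, SmoothPUOn E (trans i j) (base i ⊓ base j : TopologicalSpace.Opens X)

attribute [instance] PrincipalPUBundle.action

namespace PrincipalPUBundle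

variable {E H X}
variable (P : PrincipalPUBundle.{v} E H X) (U : TopologicalSpace.Opens X)

/-- The part `P|_U` of the total space that lies over `U`. -/
abbrev Over : Type v := {p : P.Total // P.proj p ∈ U}

variable {P U}

/-- The right action of `PU(H)` on `P|_U`. -/
def Over.act (p : P.Over U) (g : PU H) : P.Over U :=
  ⟨MulOpposite.op g • p.1, by rw [P.proj_smul]; exact p.2⟩

open Classical in
/-- The function that represents `s` over `U ∩ base i` in the `i`-th local trivialisation:
`x ↦ s (sec i x)`. -/
def localRep (s : P.Over U → TraceClass H) (i : P.Index) (x : X) : TraceClass H :=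
  if h : P.proj (P.sec i x) ∈ U then s ⟨P.sec i x, h⟩ else 0

theorem localRep_add (s t : P.Over U → TraceClass H) (i : P.Index) :
    localRep (s + t) i = localRep s i + localRep t i := by
  ext1 x; simp only [localRep, Pi.add_apply]; split_ifs <;> simp

theorem localRep_mul (s t : P.Over U → TraceClass H) (i : P.Index) :
    localRep (s * t) i = localRep s i * localRep t i := by
  ext1 x; simp only [localRep, Pi.mul_apply]; split_ifs <;> simp

theorem localRep_smul (c : ℂ) (s : P.Over U → TraceClass H) (i : P.Index) :
    localRep (c • s) i = c • localRep s i := by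
  ext1 x; simp only [localRep, Pi.smul_apply]; split_ifs <;> simp

theorem localRep_zero (i : P.Index) : localRep (0 : P.Over U → TraceClass H) i = 0 := by
  ext1 x; simp [localRep]

/-- Smoothness of a section: smoothness in all local trivialisations. -/
def SmoothSection (s : P.Over U → TraceClass H) : Prop :=
  ∀ i, ContMDiffOn 𝓘(ℝ, E) 𝓘(ℝ, TraceClass H) ∞ (localRep s i) (U ⊓ P.base i : TopologicalSpace.Opens X)

theorem contDiff_mul_traceClass :
    ContDiff ℝ ∞ (fun p : TraceClass H × TraceClass H => p.1 * p.2) :=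
  (ContinuousLinearMap.mul ℝ (TraceClass H)).isBoundedBilinearMap.contDiff

variable (P U)

/-- The smooth sections over `U` of the associated bundle `L¹(P) = P ×_{PU(H)} L¹(H)` (for the
adjoint action), as a pointwise algebra. A section is written as the corresponding equivariant
function `s : P|_U → L¹(H)`, `s (p · g) = Ad g⁻¹ (s p)`. -/
def sectionAlgebra : NonUnitalSubalgebra ℂ (P.Over U → TraceClass H) where
  carrier := {s | (∀ p g, s (p.act g) = Ad g⁻¹ (s p)) ∧ SmoothSection s}
  add_mem' := by
    rintro s t ⟨hs, hs'⟩ ⟨ht, ht'⟩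
    refine ⟨fun p g => by simp [hs, ht], fun i => ?_⟩
    rw [localRep_add]
    exact (hs' i).add (ht' i)
  zero_mem' := ⟨fun p g => by simp, fun i => by rw [localRep_zero]; exact contMDiffOn_const⟩
  mul_mem' := by
    rintro s t ⟨hs, hs'⟩ ⟨ht, ht'⟩
    refine ⟨fun p g => by simp [hs, ht, Ad_mul], fun i => ?_⟩
    rw [localRep_mul]
    exact contDiff_mul_traceClass.contMDiff.comp_contMDiffOn ((hs' i).prodMk_space (ht' i))
  smul_mem' := by
    rintro c s ⟨hs, hs'⟩
    refine ⟨fun p g => by simp [hs], fun i => ?_⟩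
    rw [localRep_smul]
    exact ((c • ContinuousLinearMap.id ℝ (TraceClass H)).contDiff (n := ∞)).contMDiff.comp_contMDiffOn (hs' i)

/-- The algebra `C^∞(U, L¹(P))`; its topology is defined below. -/
def Sections : Type _ := P.sectionAlgebra U

namespace Sections

instance : NonUnitalRing (P.Sections U) := inferInstanceAs (NonUnitalRing (P.sectionAlgebra U))
instance : Module ℂ (P.Sections U) := inferInstanceAs (Module ℂ (P.sectionAlgebra U))
instance : IsScalarTower ℂ (P.Sections U) (P.Sections U) :=
  inferInstanceAs (IsScalarTower ℂ (P.sectionAlgebra U) (P.sectionAlgebra U))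
instance : SMulCommClass ℂ (P.Sections U) (P.Sections U) :=
  inferInstanceAs (SMulCommClass ℂ (P.sectionAlgebra U) (P.sectionAlgebra U))

variable {P U}

/-- The underlying equivariant function. -/
def val (s : P.Sections U) : P.Over U → TraceClass H := Subtype.val s

theorem val_add (s t : P.Sections U) : (s + t).val = s.val + t.val := rfl
theorem val_sub (s t : P.Sections U) : (s - t).val = s.val - t.val := rfl
theorem val_mul (s t : P.Sections U) : (s * t).val = s.val * t.val := rfl
theorem val_smul (c : ℂ) (s : P.Sections U) : (c • s).val = c • s.val := rfl
theorem val_injective : Function.Injective (val : P.Sections U → _) := Subtype.val_injective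

theorem smooth (s : P.Sections U) : SmoothSection s.val := s.property.2

variable (P) in
/-- The domain in a chart `φ` of the representative of a section over `U` in the `i`-th
trivialisation. -/
def chartDomain (U : TopologicalSpace.Opens X) (i : P.Index) (φ : OpenPartialHomeomorph X E) :
    Set E :=
  φ.target ∩ φ.symm ⁻¹' (U ⊓ P.base i : TopologicalSpace.Opens X)

theorem isOpen_chartDomain (i : P.Index) (φ : OpenPartialHomeomorph X E) :
    IsOpen (chartDomain P U i φ) :=
  φ.isOpen_inter_preimage_symm (U ⊓ P.base i).isOpen

/-- The representative of a section in the `i`-th trivialisation and the chart `φ`. -/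
def chartRep (s : P.Sections U) (i : P.Index) (φ : OpenPartialHomeomorph X E) :
    E → TraceClass H :=
  localRep s.val i ∘ φ.symm

variable (P U) in
/-- A trivialisation, a chart, a compact subset of the common domain, and an order. -/
structure JetIndex where
  /-- the trivialisation -/
  i : P.Index
  /-- the chart -/
  φ : OpenPartialHomeomorph X E
  mem_atlas : φ ∈ atlas E X
  /-- the compact set -/
  K : TopologicalSpace.Compacts E
  subset : (K : Set E) ⊆ chartDomain P U i φ
  /-- the order of differentiation -/
  order : ℕ

variable [IsManifold 𝓘(ℝ, E) ∞ X]

theorem contDiffOn_chartRep (s : P.Sections U) (i : P.Index) {φ : OpenPartialHomeomorph X E}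
    (hφ : φ ∈ atlas E X) : ContDiffOn ℝ ∞ (chartRep s i φ) (chartDomain P U i φ) := by
  rw [← contMDiffOn_iff_contDiffOn]
  refine (s.smooth i).comp ((contMDiffOn_symm_of_mem_maximalAtlas
    (IsManifold.subset_maximalAtlas hφ)).mono Set.inter_subset_left) ?_
  exact fun y hy => hy.2

theorem contDiffAt_chartRep (s : P.Sections U) (a : JetIndex P U) {y : E} (hy : y ∈ a.K) (n : ℕ) :
    ContDiffAt ℝ n (chartRep s a.i a.φ) y :=
  ((contDiffOn_chartRep s a.i a.mem_atlas).contDiffAt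
    ((isOpen_chartDomain a.i a.φ).mem_nhds (a.subset hy))).of_le (by exact_mod_cast le_top)

theorem bddAbove_jet (s : P.Sections U) (a : JetIndex P U) :
    BddAbove (Set.range fun y : a.K => ‖iteratedFDeriv ℝ a.order (chartRep s a.i a.φ) y‖) := by
  have h := ((contDiffOn_chartRep s a.i a.mem_atlas).continuousOn_iteratedFDerivWithin
    (m := a.order) (by exact_mod_cast le_top) (isOpen_chartDomain a.i a.φ).uniqueDiffOn)
  have h2 : ContinuousOn (iteratedFDeriv ℝ a.order (chartRep s a.i a.φ)) a.K :=
    (h.congr fun y hy =>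
      (iteratedFDerivWithin_of_isOpen a.order (isOpen_chartDomain a.i a.φ) hy).symm).mono a.subset
  have h3 := a.K.isCompact.bddAbove_image (f := fun y => ‖iteratedFDeriv ℝ a.order
    (chartRep s a.i a.φ) y‖) h2.norm
  refine h3.mono ?_
  rintro _ ⟨y, rfl⟩
  exact ⟨y, y.2, rfl⟩

/-- The seminorm `sup_{y ∈ a.K} ‖D^{a.order} s (y)‖` of a section `s`, the derivative being that of
the representative of `s` in the trivialisation and the chart of `a`, measured in the trace
norm. -/
def jetSeminorm (a : JetIndex P U) : Seminorm ℂ (P.Sections U) :=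
  Seminorm.ofSMulLE (fun s => ⨆ y : a.K, ‖iteratedFDeriv ℝ a.order (chartRep s a.i a.φ) y‖)
    (by
      have : chartRep (0 : P.Sections U) a.i a.φ = fun _ => 0 := by
        unfold chartRep
        change localRep (0 : P.Over U → TraceClass H) a.i ∘ a.φ.symm = _
        rw [localRep_zero]; rfl
      simp [this])
    (fun s t => by
      have : chartRep (s + t) a.i a.φ = chartRep s a.i a.φ + chartRep t a.i a.φ := by
        unfold chartRep; rw [val_add, localRep_add]; rfl
      refine Real.iSup_le (fun y => ?_) (add_nonneg (Real.iSup_nonneg fun _ => norm_nonneg _)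
        (Real.iSup_nonneg fun _ => norm_nonneg _))
      rw [this, iteratedFDeriv_add_apply (contDiffAt_chartRep s a y.2 _)
        (contDiffAt_chartRep t a y.2 _)]
      exact (norm_add_le _ _).trans
        (add_le_add (le_ciSup (bddAbove_jet s a) y) (le_ciSup (bddAbove_jet t a) y)))
    (fun c s => by
      have : chartRep (c • s) a.i a.φ = c • chartRep s a.i a.φ := by
        unfold chartRep; rw [val_smul, localRep_smul]; rfl
      refine Real.iSup_le (fun y => ?_) (mul_nonneg (norm_nonneg _)
        (Real.iSup_nonneg fun _ => norm_nonneg _))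
      rw [this, iteratedFDeriv_const_smul_apply (contDiffAt_chartRep s a y.2 _), norm_smul]
      exact mul_le_mul_of_nonneg_left (le_ciSup (bddAbove_jet s a) y) (norm_nonneg _))

theorem jetSeminorm_apply (a : JetIndex P U) (s : P.Sections U) :
    jetSeminorm a s = ⨆ y : a.K, ‖iteratedFDeriv ℝ a.order (chartRep s a.i a.φ) y‖ := rfl

theorem le_jetSeminorm (a : JetIndex P U) (s : P.Sections U) {y : E} (hy : y ∈ a.K) :
    ‖iteratedFDeriv ℝ a.order (chartRep s a.i a.φ) y‖ ≤ jetSeminorm a s :=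
  le_ciSup (bddAbove_jet s a) (⟨y, hy⟩ : a.K)

variable (P U) in
/-- The family of all these seminorms. -/
def jetFamily : SeminormFamily ℂ (P.Sections U) (JetIndex P U) := jetSeminorm

/-- The usual `C^∞` topology on `C^∞(U, L¹(P))`: uniform convergence, on compact subsets of chart
and trivialisation domains, of all derivatives in the trace norm. -/
instance : TopologicalSpace (P.Sections U) := (jetFamily P U).moduleFilterBasis.topology

theorem withSeminorms : WithSeminorms (jetFamily P U) := ⟨rfl⟩

instance : IsTopologicalAddGroup (P.Sections U) := withSeminorms.topologicalAddGroup

instance : ContinuousSMul ℂ (P.Sections U) := withSeminorms.continuousSMul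

instance : PolynormableSpace ℂ (P.Sections U) := withSeminorms.toPolynormableSpace

/-- The index `a` with another order of differentiation. -/
def JetIndex.withOrder (a : JetIndex P U) (n : ℕ) : JetIndex P U := { a with order := n }

theorem jetSeminorm_mul_le (a : JetIndex P U) (s t : P.Sections U) :
    jetSeminorm a (s * t) ≤ ∑ k ∈ Finset.range (a.order + 1),
      (a.order.choose k : ℝ) * jetSeminorm (a.withOrder k) s *
        jetSeminorm (a.withOrder (a.order - k)) t := by
  refine Real.iSup_le (fun y => ?_) (Finset.sum_nonneg fun k _ =>
    mul_nonneg (mul_nonneg (Nat.cast_nonneg _) (apply_nonneg _ _)) (apply_nonneg _ _))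
  have hy : (y : E) ∈ chartDomain P U a.i a.φ := a.subset y.2
  have ho := isOpen_chartDomain (P := P) (U := U) a.i a.φ
  have hmul : chartRep (s * t) a.i a.φ =
      fun z => (ContinuousLinearMap.mul ℝ (TraceClass H)) (chartRep s a.i a.φ z)
        (chartRep t a.i a.φ z) := by
    unfold chartRep; rw [val_mul, localRep_mul]; rfl
  have h := (ContinuousLinearMap.mul ℝ
    (TraceClass H)).norm_iteratedFDerivWithin_le_of_bilinear_of_le_one
      (contDiffOn_chartRep s a.i a.mem_atlas) (contDiffOn_chartRep t a.i a.mem_atlas)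
      ho.uniqueDiffOn hy (n := a.order) (by exact_mod_cast le_top)
      (ContinuousLinearMap.opNorm_mul_le ℝ (TraceClass H))
  rw [← hmul, iteratedFDerivWithin_of_isOpen _ ho hy] at h
  refine h.trans (Finset.sum_le_sum fun k _ => ?_)
  rw [iteratedFDerivWithin_of_isOpen _ ho hy, iteratedFDerivWithin_of_isOpen _ ho hy]
  gcongr
  · exact le_jetSeminorm (a.withOrder k) s y.2
  · exact le_jetSeminorm (a.withOrder (a.order - k)) t y.2

instance : ContinuousMul (P.Sections U) where
  continuous_mul := by
    refine continuous_iff_continuousAt.2 fun ⟨s₀, t₀⟩ => ?_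
    refine (withSeminorms.tendsto_nhds _ _).2 fun a ε hε => ?_
    have hb : ∀ p : P.Sections U × P.Sections U,
        jetFamily P U a (p.1 * p.2 - s₀ * t₀) ≤
          (∑ k ∈ Finset.range (a.order + 1), (a.order.choose k : ℝ) *
            jetFamily P U (a.withOrder k) (p.1 - s₀) *
              jetFamily P U (a.withOrder (a.order - k)) p.2) +
          ∑ k ∈ Finset.range (a.order + 1), (a.order.choose k : ℝ) *
            jetFamily P U (a.withOrder k) s₀ *
              jetFamily P U (a.withOrder (a.order - k)) (p.2 - t₀) := fun p => by
      have : p.1 * p.2 - s₀ * t₀ = (p.1 - s₀) * p.2 + s₀ * (p.2 - t₀) := by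
        rw [sub_mul, mul_sub]; abel
      rw [this]
      exact (map_add_le_add _ _ _).trans
        (add_le_add (jetSeminorm_mul_le _ _ _) (jetSeminorm_mul_le _ _ _))
    have hc : Continuous fun p : P.Sections U × P.Sections U =>
        (∑ k ∈ Finset.range (a.order + 1), (a.order.choose k : ℝ) *
            jetFamily P U (a.withOrder k) (p.1 - s₀) *
              jetFamily P U (a.withOrder (a.order - k)) p.2) +
          ∑ k ∈ Finset.range (a.order + 1), (a.order.choose k : ℝ) *
            jetFamily P U (a.withOrder k) s₀ *
              jetFamily P U (a.withOrder (a.order - k)) (p.2 - t₀) := by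
      have hj : ∀ k, Continuous (jetFamily P U (a.withOrder k)) :=
        fun k => withSeminorms.continuous_seminorm _
      fun_prop
    have hz := hc.tendsto (s₀, t₀)
    simp only [sub_self, map_zero, mul_zero, zero_mul, Finset.sum_const_zero, add_zero] at hz
    filter_upwards [hz.eventually (gt_mem_nhds hε)] with p hp
    exact (hb p).trans_lt hp

theorem continuous_of_jet {V : TopologicalSpace.Opens X} (f : P.Sections U →ₗ[ℂ] P.Sections V)
    (h : ∀ a : JetIndex P V, ∃ b : JetIndex P U, ∀ s, jetSeminorm a (f s) = jetSeminorm b s) :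
    Continuous f := by
  refine continuous_of_continuousAt_zero f ?_
  refine (withSeminorms.tendsto_nhds _ _).2 fun a ε hε => ?_
  obtain ⟨b, hb⟩ := h a
  have hc : Continuous (jetFamily P U b) := withSeminorms.continuous_seminorm _
  have hz := hc.tendsto 0
  rw [map_zero] at hz
  filter_upwards [hz.eventually (gt_mem_nhds hε)] with s hs
  rw [map_zero, sub_zero]
  exact (hb s).trans_lt hs

/-- Restriction of sections to a smaller open set. -/
def restrict {V : TopologicalSpace.Opens X} (h : V ≤ U) : P.Sections U →L[ℂ] P.Sections V :=
  have hrep : ∀ (s : P.Over U → TraceClass H) (i : P.Index), ∀ x ∈ V ⊓ P.base i,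
      localRep (fun p : P.Over V => s ⟨p.1, h p.2⟩) i x = localRep s i x := fun s i x hx => by
    have h1 : P.proj (P.sec i x) ∈ V := by rw [P.proj_sec i x hx.2]; exact hx.1
    simp only [localRep, dif_pos h1, dif_pos (h h1)]
  let f : P.Sections U →ₗ[ℂ] P.Sections V :=
    { toFun := fun s => ⟨fun p => s.val ⟨p.1, h p.2⟩,
        fun p g => s.property.1 ⟨p.1, h p.2⟩ g,
        fun i => ((s.smooth i).mono fun x hx => ⟨h hx.1, hx.2⟩).congr (hrep s.val i)⟩
      map_add' := fun _ _ => rfl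
      map_smul' := fun _ _ => rfl }
  { f with
    cont := continuous_of_jet f fun a => by
      have hsub : (a.K : Set E) ⊆ chartDomain P U a.i a.φ :=
        fun y hy => ⟨(a.subset hy).1, h (a.subset hy).2.1, (a.subset hy).2.2⟩
      refine ⟨⟨a.i, a.φ, a.mem_atlas, a.K, hsub, a.order⟩, fun s => ?_⟩
      rw [jetSeminorm_apply, jetSeminorm_apply]
      refine iSup_congr fun y => ?_
      have key : chartRep (f s) a.i a.φ =ᶠ[𝓝 (y : E)] chartRep s a.i a.φ := by
        filter_upwards [(isOpen_chartDomain a.i a.φ).mem_nhds (a.subset y.2)] with z hz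
        exact hrep s.val a.i _ hz.2
      rw [(key.iteratedFDeriv ℝ a.order).eq_of_nhds] }

theorem restrict_apply {V : TopologicalSpace.Opens X} (h : V ≤ U) (s : P.Sections U)
    (p : P.Over V) : (restrict h s).val p = s.val ⟨p.1, h p.2⟩ := rfl

end Sections

end PrincipalPUBundle

end Bundle

/-! ### Completed projective tensor powers -/

section ProjectiveTensor

variable (A : Type*) [NonUnitalRing A] [Module ℂ A]

/-- The algebraic tensor power `A ⊗ ⋯ ⊗ A` (`n` factors over `ℂ`); it carries the projective
topology defined below. -/
def AlgTensor (n : ℕ) : Type _ := ⨂[ℂ] _ : Fin n, A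

namespace AlgTensor

variable (n : ℕ)

instance : AddCommGroup (AlgTensor A n) := inferInstanceAs (AddCommGroup (⨂[ℂ] _ : Fin n, A))
instance : Module ℂ (AlgTensor A n) := inferInstanceAs (Module ℂ (⨂[ℂ] _ : Fin n, A))

variable {A n}

/-- The elementary tensor `v₀ ⊗ ⋯ ⊗ vₙ₋₁`. -/
def tprod : MultilinearMap ℂ (fun _ : Fin n => A) (AlgTensor A n) := PiTensorProduct.tprod ℂ

/-- The cost `∑ |c| p(v₀) ⋯ p(vₙ₋₁)` of a representation `∑ c (v₀ ⊗ ⋯ ⊗ vₙ₋₁)` of a tensor. -/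
def cost (p : Seminorm ℂ A) (r : FreeAddMonoid (ℂ × (Fin n → A))) : ℝ :=
  (r.toList.map fun x => ‖x.1‖ * ∏ i, p (x.2 i)).sum

theorem cost_nonneg (p : Seminorm ℂ A) (r : FreeAddMonoid (ℂ × (Fin n → A))) : 0 ≤ cost p r := by
  refine List.sum_nonneg fun a => ?_
  simp only [List.mem_map, Prod.exists, forall_exists_index, and_imp]
  rintro c v _ rfl
  exact mul_nonneg (norm_nonneg _) (Finset.prod_nonneg fun i _ => apply_nonneg p _)

theorem bddBelow_cost (p : Seminorm ℂ A) (z : ⨂[ℂ] _ : Fin n, A) :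
    BddBelow (Set.range fun r : PiTensorProduct.lifts z => cost p r.1) :=
  ⟨0, by rintro _ ⟨r, rfl⟩; exact cost_nonneg p r.1⟩

/-- The projective seminorm `p ⊗ ⋯ ⊗ p`: the infimum of `∑ |c| p(v₀) ⋯ p(vₙ₋₁)` over all
representations `z = ∑ c (v₀ ⊗ ⋯ ⊗ vₙ₋₁)`. -/
def projSeminorm (p : Seminorm ℂ A) : Seminorm ℂ (AlgTensor A n) :=
  Seminorm.ofSMulLE (E := ⨂[ℂ] _ : Fin n, A)
    (fun z => ⨅ r : PiTensorProduct.lifts z, cost p r.1)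
    (le_antisymm ((ciInf_le (bddBelow_cost p 0) ⟨0, PiTensorProduct.lifts_zero⟩).trans_eq
        (by simp [cost])) (le_ciInf fun r => cost_nonneg p r.1))
    (fun x y => le_ciInf_add_ciInf fun r s => ciInf_le_of_le (bddBelow_cost p _)
      ⟨r.1 + s.1, PiTensorProduct.lifts_add r.2 s.2⟩ (by simp [cost]))
    (fun c x => by
      change _ ≤ ‖c‖ * ⨅ r : PiTensorProduct.lifts x, cost p r.1
      rw [Real.mul_iInf_of_nonneg (norm_nonneg _)]
      refine le_ciInf fun r => ciInf_le_of_le (bddBelow_cost p _)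
        ⟨_, PiTensorProduct.lifts_smul r.2 c⟩ (le_of_eq ?_)
      simp [cost, Function.comp_def, mul_assoc, List.sum_map_mul_left])

theorem projSeminorm_tprod_le (p : Seminorm ℂ A) (v : Fin n → A) :
    projSeminorm p (tprod v) ≤ ∏ i, p (v i) := by
  refine (ciInf_le (bddBelow_cost p (PiTensorProduct.tprod ℂ v))
    ⟨FreeAddMonoid.of (1, v), by simp [PiTensorProduct.mem_lifts_iff]⟩).trans_eq ?_
  simp [cost]

/-- The universal property of projective seminorms. -/
theorem le_projSeminorm_of_tprod {G : Type*} [AddCommGroup G] [Module ℂ G] (q : Seminorm ℂ G)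
    (f : AlgTensor A n →ₗ[ℂ] G) (p : Seminorm ℂ A)
    (h : ∀ v, q (f (tprod v)) ≤ ∏ i, p (v i)) (z : AlgTensor A n) :
    q (f z) ≤ projSeminorm p z := by
  have : ∀ l : List (ℂ × (Fin n → A)), q (f (l.map fun x => x.1 • tprod x.2).sum) ≤
      (l.map fun x => ‖x.1‖ * ∏ i, p (x.2 i)).sum := by
    intro l
    induction l with
    | nil => simp
    | cons a l ih =>
      simp only [List.map_cons, List.sum_cons, map_add, map_smul]
      refine (map_add_le_add q _ _).trans (add_le_add ?_ ih)
      rw [map_smul_eq_mul]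
      exact mul_le_mul_of_nonneg_left (h _) (norm_nonneg _)
  have hz : Nonempty (PiTensorProduct.lifts z) := (PiTensorProduct.nonempty_lifts z).to_subtype
  refine le_ciInf (f := fun r : PiTensorProduct.lifts z => cost p r.1) fun r => ?_
  have hr := (PiTensorProduct.mem_lifts_iff z r.1).1 r.2
  exact (congrArg (fun w => q (f w)) hr).symm.le.trans (this r.1.toList)

section

/-- The tuple `(v₀, …, vⱼ vⱼ₊₁, …, vₙ)`. -/
def mergeAt (j : Fin n) (v : Fin (n + 1) → A) (i : Fin n) : A :=
  if i < j then v i.castSucc else if i = j then v i.castSucc * v i.succ else v i.succ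


theorem prod_mergeAt_le (p q : Seminorm ℂ A) (hpq : q ≤ p) (hmul : ∀ a b, q (a * b) ≤ p a * p b)
    (j : Fin n) (v : Fin (n + 1) → A) : ∏ i, q (mergeAt j v i) ≤ ∏ i, p (v i) := by
  rw [Fin.prod_univ_succAbove _ j.castSucc,
    ← Finset.mul_prod_erase Finset.univ _ (Finset.mem_univ j),
    ← Finset.mul_prod_erase Finset.univ (fun i => p (v (j.castSucc.succAbove i)))
      (Finset.mem_univ j), ← mul_assoc]
  refine mul_le_mul ?_ (Finset.prod_le_prod (fun i _ => apply_nonneg q _) fun i hi => ?_)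
    (Finset.prod_nonneg fun i _ => apply_nonneg q _)
    (mul_nonneg (apply_nonneg p _) (apply_nonneg p _))
  · simpa [mergeAt] using hmul _ _
  · have hij : i ≠ j := Finset.ne_of_mem_erase hi
    rcases lt_or_gt_of_ne hij with h | h
    · rw [Fin.succAbove_of_castSucc_lt _ _ (by simpa using h)]
      simpa [mergeAt, h] using hpq _
    · rw [Fin.succAbove_of_le_castSucc _ _ (by simpa using h.le)]
      simpa [mergeAt, h.not_gt, hij] using hpq _

variable [IsScalarTower ℂ A A] [SMulCommClass ℂ A A]

theorem mergeAt_update (j : Fin n) (v : Fin (n + 1) → A) (m : Fin (n + 1)) :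
    ∃ L : A →ₗ[ℂ] A, ∀ x, mergeAt j (Function.update v m x) =
      Function.update (mergeAt j v) (j.predAbove m) (L x) := by
  have hne : ∀ i, i ≠ j.predAbove m → ∀ x,
      mergeAt j (Function.update v m x) i = mergeAt j v i := fun i hi x => by
    simp only [mergeAt]
    have h1 : i ≤ j → i.castSucc ≠ m := by
      rintro hij rfl; exact hi (Fin.predAbove_castSucc_of_le _ _ hij).symm
    have h2 : j ≤ i → i.succ ≠ m := by
      rintro hij rfl; exact hi (Fin.predAbove_succ_of_le _ _ hij).symm
    split_ifs with h h'
    · rw [Function.update_of_ne (h1 h.le)]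
    · rw [Function.update_of_ne (h1 h'.le), Function.update_of_ne (h2 h'.ge)]
    · rw [Function.update_of_ne (h2 (not_lt.1 h))]
  suffices ∃ L : A →ₗ[ℂ] A, ∀ x,
      mergeAt j (Function.update v m x) (j.predAbove m) = L x by
    obtain ⟨L, hL⟩ := this
    refine ⟨L, fun x => funext fun i => ?_⟩
    by_cases hi : i = j.predAbove m
    · subst hi; rw [hL, Function.update_self]
    · rw [hne i hi, Function.update_of_ne hi]
  by_cases hm : m ≤ j.castSucc
  · obtain ⟨i, rfl⟩ : ∃ i : Fin n, m = i.castSucc :=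
      ⟨m.castPred (Fin.ne_last_of_lt (hm.trans_lt (Fin.castSucc_lt_last j))), by simp⟩
    have hij : i ≤ j := by simpa using hm
    rw [Fin.predAbove_castSucc_of_le _ _ hij]
    rcases hij.lt_or_eq with h | rfl
    · exact ⟨LinearMap.id, fun x => by simp [mergeAt, h]⟩
    · exact ⟨LinearMap.mulRight ℂ (v i.succ), fun x => by
        simp [mergeAt, Function.update_of_ne (Fin.castSucc_lt_succ (i := i)).ne']⟩
  · obtain ⟨i, rfl⟩ : ∃ i : Fin n, m = i.succ :=
      ⟨m.pred (Fin.ne_zero_of_lt (not_le.1 hm)), by simp⟩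
    have hij : j ≤ i := by simpa [Fin.castSucc_lt_succ_iff] using hm
    rw [Fin.predAbove_succ_of_le _ _ hij]
    rcases hij.lt_or_eq with h | rfl
    · exact ⟨LinearMap.id, fun x => by simp [mergeAt, h.not_gt, h.ne']⟩
    · exact ⟨LinearMap.mulLeft ℂ (v j.castSucc), fun x => by
        simp [mergeAt, Function.update_of_ne (Fin.castSucc_lt_succ (i := j)).ne]⟩

/-- The linear map `v₀ ⊗ ⋯ ⊗ vₙ ↦ v₀ ⊗ ⋯ ⊗ vⱼ vⱼ₊₁ ⊗ ⋯ ⊗ vₙ`. -/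
def faceLinear (j : Fin n) : AlgTensor A (n + 1) →ₗ[ℂ] AlgTensor A n :=
  PiTensorProduct.lift
    { toFun := fun v => tprod (mergeAt j v)
      map_update_add' := fun {hd} v m x y => by
        obtain rfl : hd = instDecidableEqFin _ := Subsingleton.elim _ _
        obtain ⟨L, hL⟩ := mergeAt_update j v m
        rw [hL, hL, hL, map_add, MultilinearMap.map_update_add]
      map_update_smul' := fun {hd} v m c x => by
        obtain rfl : hd = instDecidableEqFin _ := Subsingleton.elim _ _
        obtain ⟨L, hL⟩ := mergeAt_update j v m
        rw [hL, hL, map_smul, MultilinearMap.map_update_smul] }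

theorem faceLinear_tprod (j : Fin n) (v : Fin (n + 1) → A) :
    faceLinear j (tprod v) = tprod (mergeAt j v) :=
  PiTensorProduct.lift.tprod v

end

variable (A n)
variable [TopologicalSpace A]

/-- The projective seminorms of all continuous seminorms of `A`. -/
def projFamily : SeminormFamily ℂ (AlgTensor A n) {p : Seminorm ℂ A // Continuous p} :=
  fun p => projSeminorm p.1

/-- The projective topology on `A ⊗ ⋯ ⊗ A`. -/
instance : UniformSpace (AlgTensor A n) :=
  letI : TopologicalSpace (AlgTensor A n) := (projFamily A n).moduleFilterBasis.topology
  haveI : IsTopologicalAddGroup (AlgTensor A n) :=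
    WithSeminorms.topologicalAddGroup (p := projFamily A n) ⟨rfl⟩
  IsTopologicalAddGroup.rightUniformSpace _

theorem withSeminorms : WithSeminorms (projFamily A n) := ⟨rfl⟩

instance : IsTopologicalAddGroup (AlgTensor A n) := (withSeminorms A n).topologicalAddGroup

instance : IsUniformAddGroup (AlgTensor A n) := isUniformAddGroup_of_addCommGroup

instance : ContinuousSMul ℂ (AlgTensor A n) := (withSeminorms A n).continuousSMul

instance : UniformContinuousConstSMul ℂ (AlgTensor A n) :=
  uniformContinuousConstSMul_of_continuousConstSMul ℂ _

variable {A n}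

theorem continuous_of_tprod {B : Type*} [NonUnitalRing B] [Module ℂ B] [TopologicalSpace B]
    {m : ℕ} (f : AlgTensor A n →ₗ[ℂ] AlgTensor B m)
    (h : ∀ q : Seminorm ℂ B, Continuous q → ∃ p : Seminorm ℂ A, Continuous p ∧
      ∀ v, projSeminorm q (f (tprod v)) ≤ ∏ i, p (v i)) : Continuous f := by
  refine continuous_of_continuousAt_zero f ?_
  refine ((withSeminorms B m).tendsto_nhds _ _).2 fun q ε hε => ?_
  obtain ⟨p, hp, hq⟩ := h q.1 q.2
  have hc : Continuous (projFamily A n ⟨p, hp⟩) := (withSeminorms A n).continuous_seminorm _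
  have hz := hc.tendsto 0
  rw [map_zero] at hz
  filter_upwards [hz.eventually (gt_mem_nhds hε)] with z hz
  rw [map_zero, sub_zero]
  exact (le_projSeminorm_of_tprod _ f p hq z).trans_lt hz

/-- The map `φ ⊗ ⋯ ⊗ φ` induced by a continuous linear map `φ`. -/
def map {B : Type*} [NonUnitalRing B] [Module ℂ B] [TopologicalSpace B] (φ : A →L[ℂ] B) (n : ℕ) :
    AlgTensor A n →L[ℂ] AlgTensor B n :=
  let f : AlgTensor A n →ₗ[ℂ] AlgTensor B n := PiTensorProduct.map fun _ => φ.toLinearMap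
  { f with
    cont := continuous_of_tprod f fun q hq => by
      refine ⟨q.comp φ.toLinearMap, hq.comp φ.continuous, fun v => ?_⟩
      have : f (tprod v) = tprod fun i => φ (v i) :=
        PiTensorProduct.map_tprod (fun _ => φ.toLinearMap) v
      rw [this]
      exact projSeminorm_tprod_le q _ }

theorem map_tprod {B : Type*} [NonUnitalRing B] [Module ℂ B] [TopologicalSpace B] (φ : A →L[ℂ] B)
    (v : Fin n → A) : map φ n (tprod v) = tprod fun i => φ (v i) :=
  PiTensorProduct.map_tprod (fun _ => φ.toLinearMap) v

variable (A n) in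
/-- The cyclic permutation `v₀ ⊗ ⋯ ⊗ vₙ₋₁ ↦ vₙ₋₁ ⊗ v₀ ⊗ ⋯ ⊗ vₙ₋₂`. -/
def rotate : AlgTensor A n →L[ℂ] AlgTensor A n :=
  let f : AlgTensor A n →ₗ[ℂ] AlgTensor A n :=
    (PiTensorProduct.reindex ℂ (fun _ : Fin n => A) (finRotate n)).toLinearMap
  { f with
    cont := continuous_of_tprod f fun q hq => by
      refine ⟨q, hq, fun v => ?_⟩
      have : f (tprod v) = tprod fun i => v ((finRotate n).symm i) :=
        PiTensorProduct.reindex_tprod (s := fun _ => A) (finRotate n) v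
      rw [this]
      exact (projSeminorm_tprod_le q _).trans_eq
        (Equiv.prod_comp (finRotate n).symm fun i => q (v i)) }

theorem rotate_tprod (v : Fin n → A) :
    rotate A n (tprod v) = tprod fun i => v ((finRotate n).symm i) :=
  PiTensorProduct.reindex_tprod (s := fun _ => A) (finRotate n) v

variable [IsScalarTower ℂ A A] [SMulCommClass ℂ A A]
variable [PolynormableSpace ℂ A] [ContinuousMul A]

variable (A) in
theorem exists_seminorm_mul_le (q : Seminorm ℂ A) (hq : Continuous q) :
    ∃ p : Seminorm ℂ A, Continuous p ∧ q ≤ p ∧ ∀ a b, q (a * b) ≤ p a * p b := by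
  have hA := PolynormableSpace.withSeminorms ℂ A
  have hc : Continuous fun x : A × A => q (x.1 * x.2) := hq.comp continuous_mul
  have h0 : ∀ᶠ x in 𝓝 ((0 : A), (0 : A)), q (x.1 * x.2) < 1 :=
    (hc.tendsto (0, 0)).eventually (gt_mem_nhds (by simp))
  rw [nhds_prod_eq, Filter.eventually_prod_iff] at h0
  obtain ⟨S, hS, T, hT, hST⟩ := h0
  obtain ⟨s, r, hr, hsr⟩ := (hA.mem_nhds_iff 0 _).1 (Filter.inter_mem hS hT)
  set p₀ : Seminorm ℂ A := s.sup fun p : {p : Seminorm ℂ A // Continuous p} => p.1 with hp₀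
  have hp₀c : Continuous p₀ := by
    refine Finset.sup_induction (p := fun p : Seminorm ℂ A => Continuous p) continuous_const
      (fun a ha b hb => ?_) fun p _ => p.2
    exact Continuous.max ha hb
  set p₁ : Seminorm ℂ A := (r⁻¹).toNNReal • p₀ with hp₁
  have hp₁a : ∀ a, p₁ a = r⁻¹ * p₀ a := fun a => by
    rw [hp₁, smul_apply, NNReal.smul_def, Real.coe_toNNReal _ (inv_pos.2 hr).le, smul_eq_mul]
  have hp₁c : Continuous p₁ := by
    have : Continuous fun a => r⁻¹ * p₀ a := continuous_const.mul hp₀c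
    exact this.congr fun a => (hp₁a a).symm
  have hlt : ∀ a b, p₁ a < 1 → p₁ b < 1 → q (a * b) < 1 := fun a b ha hb => by
    have hmem : ∀ c, p₁ c < 1 → c ∈ p₀.ball 0 r := fun c hc => by
      rw [Seminorm.mem_ball_zero]
      rw [hp₁a, inv_mul_lt_iff₀ hr, mul_one] at hc
      exact hc
    exact hST (hsr (hmem a ha)).1 (hsr (hmem b hb)).2
  have hle : ∀ a b, q (a * b) ≤ p₁ a * p₁ b := fun a b => by
    have key : ∀ ε : ℝ, 0 < ε → q (a * b) ≤ (p₁ a + ε) * (p₁ b + ε) := fun ε hε => by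
      have hn : ∀ c, 0 < p₁ c + ε := fun c => add_pos_of_nonneg_of_pos (apply_nonneg _ _) hε
      have hs : ∀ c, p₁ (((p₁ c + ε)⁻¹ : ℂ) • c) < 1 := fun c => by
        rw [map_smul_eq_mul, norm_inv, ← Complex.ofReal_add, Complex.norm_real,
          Real.norm_of_nonneg (hn c).le, inv_mul_lt_iff₀ (hn c)]
        linarith
      have h1 := hlt _ _ (hs a) (hs b)
      rw [smul_mul_assoc, mul_smul_comm, smul_smul, map_smul_eq_mul, norm_mul, norm_inv, norm_inv,
        ← Complex.ofReal_add, ← Complex.ofReal_add, Complex.norm_real, Complex.norm_real,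
        Real.norm_of_nonneg (hn a).le, Real.norm_of_nonneg (hn b).le, ← mul_inv,
        inv_mul_lt_iff₀ (mul_pos (hn a) (hn b))] at h1
      linarith
    have ht : Filter.Tendsto (fun ε : ℝ => (p₁ a + ε) * (p₁ b + ε)) (𝓝[>] 0)
        (𝓝 (p₁ a * p₁ b)) := by
      have : Continuous fun ε : ℝ => (p₁ a + ε) * (p₁ b + ε) := by fun_prop
      simpa using (this.tendsto 0).mono_left nhdsWithin_le_nhds
    exact ge_of_tendsto ht (Filter.eventually_of_mem self_mem_nhdsWithin key)
  refine ⟨p₁ ⊔ q, Continuous.max hp₁c hq, le_sup_right, fun a b => (hle a b).trans ?_⟩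
  exact mul_le_mul le_sup_left le_sup_left (apply_nonneg _ _) (apply_nonneg (p₁ ⊔ q) _)

variable (A) in
/-- The `j`-th face map `v₀ ⊗ ⋯ ⊗ vₙ ↦ v₀ ⊗ ⋯ ⊗ vⱼ vⱼ₊₁ ⊗ ⋯ ⊗ vₙ`. -/
def face (j : Fin n) : AlgTensor A (n + 1) →L[ℂ] AlgTensor A n :=
  { faceLinear (A := A) j with
    cont := continuous_of_tprod (faceLinear j) fun q hq => by
      obtain ⟨p, hp, hpq, hmul⟩ := exists_seminorm_mul_le A q hq
      refine ⟨p, hp, fun v => ?_⟩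
      rw [faceLinear_tprod]
      exact (projSeminorm_tprod_le q _).trans (prod_mergeAt_le p q hpq hmul j v) }

theorem face_tprod (j : Fin n) (v : Fin (n + 1) → A) :
    face A j (tprod v) = tprod (mergeAt j v) :=
  faceLinear_tprod j v

end AlgTensor

end ProjectiveTensor

/-! ### The Hochschild, cyclic and periodic cyclic complexes -/

section CyclicComplexes

/-- The completed projective tensor power `A ⊗̂ ⋯ ⊗̂ A` (`n` factors). -/
abbrev ProjTensor (A : Type*) [NonUnitalRing A] [Module ℂ A] [TopologicalSpace A] (n : ℕ) :
    Type _ :=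
  UniformSpace.Completion (AlgTensor A n)

namespace ProjTensor

section Linear

variable (A : Type*) [NonUnitalRing A] [Module ℂ A] [TopologicalSpace A]

/-- The map induced by a continuous linear map. -/
def map {A B : Type*} [NonUnitalRing A] [Module ℂ A] [TopologicalSpace A]
    [NonUnitalRing B] [Module ℂ B] [TopologicalSpace B] (φ : A →L[ℂ] B) (n : ℕ) :
    ProjTensor A n →L[ℂ] ProjTensor B n :=
  (AlgTensor.map φ n).completion

/-- The signed cyclic permutation `v₀ ⊗ ⋯ ⊗ vₙ ↦ (-1)ⁿ vₙ ⊗ v₀ ⊗ ⋯ ⊗ vₙ₋₁` (on `n + 1` factors). -/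
def lam : ∀ n : ℕ, ProjTensor A n →L[ℂ] ProjTensor A n
  | 0 => ContinuousLinearMap.id ℂ _
  | n + 1 => (-1 : ℂ) ^ n • (AlgTensor.rotate A (n + 1)).completion

/-- The norm operator `Q = ∑ λʲ`, `0 ≤ j < n`, on `n` factors. -/
def Q (n : ℕ) : ProjTensor A n →L[ℂ] ProjTensor A n := ∑ j ∈ Finset.range n, lam A n ^ j

end Linear

variable (A : Type*) [NonUnitalRing A] [Module ℂ A] [IsScalarTower ℂ A A] [SMulCommClass ℂ A A]
  [TopologicalSpace A] [PolynormableSpace ℂ A] [ContinuousMul A]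

/-- The face map `v₀ ⊗ ⋯ ⊗ vₙ ↦ v₀ ⊗ ⋯ ⊗ vⱼ vⱼ₊₁ ⊗ ⋯ ⊗ vₙ`, for `j < n`. -/
def face {n : ℕ} (j : Fin n) : ProjTensor A (n + 1) →L[ℂ] ProjTensor A n :=
  (AlgTensor.face A j).completion

/-- The bar differential
`b' (v₀ ⊗ ⋯ ⊗ vₙ) = ∑ (-1)ʲ v₀ ⊗ ⋯ ⊗ vⱼ vⱼ₊₁ ⊗ ⋯ ⊗ vₙ`, `0 ≤ j < n`. -/
def bar (n : ℕ) : ProjTensor A (n + 1) →L[ℂ] ProjTensor A n :=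
  ∑ j : Fin n, (-1 : ℂ) ^ (j : ℕ) • face A j

/-- The Hochschild differential
`b (v₀ ⊗ ⋯ ⊗ vₙ₊₁) = b' (v₀ ⊗ ⋯ ⊗ vₙ₊₁) + (-1)ⁿ⁺¹ vₙ₊₁ v₀ ⊗ v₁ ⊗ ⋯ ⊗ vₙ`; the last summand is the
composition of the signed cyclic permutation with the face map for `j = 0`. -/
def b (n : ℕ) : ProjTensor A (n + 2) →L[ℂ] ProjTensor A (n + 1) :=
  bar A (n + 1) + face A 0 ∘L lam A (n + 2)

end ProjTensor

/-- The reduced Hochschild chains `CC₀(A) = A` and `CC_k(A) = Ã ⊗̂ A^{⊗̂ k}` for `k ≥ 1`, where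
`Ã = A ⊕ ℂ` is the unitalisation of `A`. In view of `Ã ⊗̂ A^{⊗̂ k} = A^{⊗̂ (k+1)} ⊕ A^{⊗̂ k}` they are
written as pairs. -/
def CC (A : Type*) [NonUnitalRing A] [Module ℂ A] [TopologicalSpace A] : ℕ → Type _
  | 0 => ProjTensor A 1
  | k + 1 => ProjTensor A (k + 2) × ProjTensor A (k + 1)

namespace CC

section Linear

variable (A : Type*) [NonUnitalRing A] [Module ℂ A] [TopologicalSpace A]

instance : ∀ k, AddCommGroup (CC A k)
  | 0 => inferInstanceAs (AddCommGroup (ProjTensor A 1))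
  | k + 1 => inferInstanceAs (AddCommGroup (ProjTensor A (k + 2) × ProjTensor A (k + 1)))

instance : ∀ k, Module ℂ (CC A k)
  | 0 => inferInstanceAs (Module ℂ (ProjTensor A 1))
  | k + 1 => inferInstanceAs (Module ℂ (ProjTensor A (k + 2) × ProjTensor A (k + 1)))

/-- The map of Hochschild chains induced by a continuous linear map (for instance, a continuous
homomorphism of algebras). -/
def map {A B : Type*} [NonUnitalRing A] [Module ℂ A] [TopologicalSpace A]
    [NonUnitalRing B] [Module ℂ B] [TopologicalSpace B] (φ : A →L[ℂ] B) :
    ∀ k, CC A k →ₗ[ℂ] CC B k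
  | 0 => (ProjTensor.map φ 1).toLinearMap
  | k + 1 => (ProjTensor.map φ (k + 2)).toLinearMap.prodMap (ProjTensor.map φ (k + 1)).toLinearMap

/-- Connes' operator `B (x, y) = (0, Q x)`. -/
def B : ∀ k, CC A k →ₗ[ℂ] CC A (k + 1)
  | 0 => LinearMap.inr ℂ (ProjTensor A 2) (ProjTensor A 1) ∘ₗ (ProjTensor.Q A 1).toLinearMap
  | k + 1 => LinearMap.inr ℂ (ProjTensor A (k + 3)) (ProjTensor A (k + 2)) ∘ₗ
      (ProjTensor.Q A (k + 2)).toLinearMap ∘ₗ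
        LinearMap.fst ℂ (ProjTensor A (k + 2)) (ProjTensor A (k + 1))

end Linear

variable (A : Type*) [NonUnitalRing A] [Module ℂ A] [IsScalarTower ℂ A A] [SMulCommClass ℂ A A]
  [TopologicalSpace A] [PolynormableSpace ℂ A] [ContinuousMul A]

/-- The map `(x, y) ↦ b x + (1 - λ) y`. -/
def bFst (k : ℕ) : ProjTensor A (k + 2) × ProjTensor A (k + 1) →ₗ[ℂ] ProjTensor A (k + 1) :=
  (ProjTensor.b A k).toLinearMap.coprod (LinearMap.id - (ProjTensor.lam A (k + 1)).toLinearMap)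

/-- The Hochschild differential `b (x, y) = (b x + (1 - λ) y, - b' y)`, and
`b (x, y) = b x + (1 - λ) y` on `CC₁(A)`. -/
def b : ∀ k, CC A (k + 1) →ₗ[ℂ] CC A k
  | 0 => bFst A 0
  | k + 1 => (bFst A (k + 1)).prod
      (-(ProjTensor.bar A (k + 1)).toLinearMap ∘ₗ
        LinearMap.snd ℂ (ProjTensor A (k + 3)) (ProjTensor A (k + 2)))

end CC

/-- The pairs `(k, q)` such that `CC_k(A) u^q` has total degree `k - 2 q = m` (the degree of `u` is
`-2`) and `q ≤ r`. -/
abbrev PowerIndex (r : WithTop ℤ) (m : ℤ) : Type :=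
  {x : ℕ × ℤ // (x.1 : ℤ) - 2 * x.2 = m ∧ (x.2 : WithTop ℤ) ≤ r}

/-- The part of degree `m` of `CC(A) ⊗ ℂ((u)) / u^{r+1} ℂ[[u]]`: the formal sums `∑ c_{k,q} u^q` with
`c_{k,q} ∈ CC_k(A)`, `k - 2 q = m` and `q ≤ r`. As `k ≥ 0`, these are Laurent series in `u`.
For `r = ⊤` this is the periodic complex, for `r = 0` the cyclic complex. -/
abbrev LaurentCC (A : Type*) [NonUnitalRing A] [Module ℂ A] [TopologicalSpace A]
    (r : WithTop ℤ) (m : ℤ) : Type _ :=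
  ∀ x : PowerIndex r m, CC A x.1.1

namespace LaurentCC

variable (A : Type*) [NonUnitalRing A] [Module ℂ A] [TopologicalSpace A]

/-- The map induced by a continuous linear map, `∑ c_{k,q} u^q ↦ ∑ φ(c_{k,q}) u^q`. -/
def map {A B : Type*} [NonUnitalRing A] [Module ℂ A] [TopologicalSpace A]
    [NonUnitalRing B] [Module ℂ B] [TopologicalSpace B] (φ : A →L[ℂ] B) (r : WithTop ℤ) (m : ℤ) :
    LaurentCC A r m →ₗ[ℂ] LaurentCC B r m :=
  LinearMap.pi fun x => CC.map φ x.1.1 ∘ₗ LinearMap.proj x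

/-- The operator `u B`: the coefficient of `u^q` in `u B c` is `B c_{k-1,q-1}` for `k ≥ 1`, and `0`
for `k = 0`. -/
def uB (r : WithTop ℤ) (m : ℤ) : LaurentCC A r (m + 1) →ₗ[ℂ] LaurentCC A r m :=
  LinearMap.pi fun
    | ⟨(0, _), _⟩ => 0
    | ⟨(k + 1, q), h⟩ => CC.B A k ∘ₗ LinearMap.proj
        (⟨(k, q - 1), by have := h.1; push_cast at this; simp only; omega,
          le_trans (by exact_mod_cast (by omega : q - 1 ≤ q)) h.2⟩ : PowerIndex r (m + 1))

variable [IsScalarTower ℂ A A] [SMulCommClass ℂ A A] [PolynormableSpace ℂ A] [ContinuousMul A]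

/-- The operator `b`, applied to the coefficients. -/
def b (r : WithTop ℤ) (m : ℤ) : LaurentCC A r (m + 1) →ₗ[ℂ] LaurentCC A r m :=
  LinearMap.pi fun x => CC.b A x.1.1 ∘ₗ LinearMap.proj
    (⟨(x.1.1 + 1, x.1.2), by have := x.2.1; push_cast; omega, x.2.2⟩ : PowerIndex r (m + 1))

/-- The differential `b + u B`. -/
def d (r : WithTop ℤ) (m : ℤ) : LaurentCC A r (m + 1) →ₗ[ℂ] LaurentCC A r m :=
  b A r m + uB A r m

end LaurentCC

end CyclicComplexes

/-! ### The Čech-type complexes -/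

section Cech

open TopologicalSpace (Opens)

/-- A good cover: an open cover all of whose non-empty finite intersections are contractible. -/
structure IsGoodCover {X I : Type*} [TopologicalSpace X] (U : I → Opens X) : Prop where
  cover : ∀ x, ∃ i, x ∈ U i
  contractible : ∀ (p : ℕ) (J : Fin (p + 1) → I), ((⨅ j, U (J j) : Opens X) : Set X).Nonempty →
    ContractibleSpace (⨅ j, U (J j) : Opens X)

universe v

variable {E H X I : Type*} [NormedAddCommGroup E] [NormedSpace ℝ E]
  [NormedAddCommGroup H] [InnerProductSpace ℂ H] [CompleteSpace H]
  [TopologicalSpace X] [ChartedSpace E X] [IsManifold 𝓘(ℝ, E) ∞ X]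
  (P : PrincipalPUBundle.{v} E H X) (U : I → Opens X)

/-- The algebra `⊕ 𝒜_{i₀ … i_p}` of smooth sections of `L¹(P)` over the disjoint union of all
`U_{i₀} ∩ ⋯ ∩ U_{i_p}`, `(i₀, …, i_p) ∈ I^{p+1}`: families of sections, with the product
topology. -/
abbrev CechAlgebra (p : ℕ) : Type _ := ∀ J : Fin (p + 1) → I, P.Sections (⨅ j, U (J j))

/-- The homomorphism `𝒜 → ⊕ 𝒜_i` that restricts a global section to the members of the cover. -/
def augmentation : P.Sections ⊤ →L[ℂ] CechAlgebra P U 0 :=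
  ContinuousLinearMap.pi fun _ => PrincipalPUBundle.Sections.restrict le_top

/-- The homomorphism `d_k : ⊕ 𝒜_{i₀ … i_p} → ⊕ 𝒜_{i₀ … i_{p+1}}` that omits the `k`-th index:
`(d_k s)_{i₀ … i_{p+1}}` is the restriction of `s_{i₀ … î_k … i_{p+1}}`. -/
def coface (p : ℕ) (k : Fin (p + 2)) : CechAlgebra P U p →L[ℂ] CechAlgebra P U (p + 1) :=
  ContinuousLinearMap.pi fun J =>
    PrincipalPUBundle.Sections.restrict (le_iInf fun j => iInf_le (fun j => U (J j)) (k.succAbove j))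
      ∘L ContinuousLinearMap.proj (J ∘ k.succAbove)

/-- `0 → K → C⁰ → C¹ → ⋯` is an exact sequence of chain complexes of vector spaces: `(K, dK)` and
all `(C p, dC p)` are complexes, `ε` and all `δ p` are chain maps, and the sequence is exact in every
degree. The degrees run through `ι`, and the differentials map degree `s n` to degree `n`. -/
structure ExactSequenceOfComplexes {ι : Type*} (s : ι → ι) {K : ι → Type*} {C : ℕ → ι → Type*}
    [∀ n, AddCommGroup (K n)] [∀ n, Module ℂ (K n)]
    [∀ p n, AddCommGroup (C p n)] [∀ p n, Module ℂ (C p n)]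
    (dK : ∀ n, K (s n) →ₗ[ℂ] K n) (dC : ∀ p n, C p (s n) →ₗ[ℂ] C p n)
    (ε : ∀ n, K n →ₗ[ℂ] C 0 n) (δ : ∀ p n, C p n →ₗ[ℂ] C (p + 1) n) : Prop where
  d_comp_d : ∀ n, dK n ∘ₗ dK (s n) = 0
  d_comp_d_term : ∀ p n, dC p n ∘ₗ dC p (s n) = 0
  augmentation_comm : ∀ n, ε n ∘ₗ dK n = dC 0 n ∘ₗ ε (s n)
  comm : ∀ p n, δ p n ∘ₗ dC p n = dC (p + 1) n ∘ₗ δ p (s n)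
  injective : ∀ n, Function.Injective (ε n)
  exact_zero : ∀ n, Function.Exact (ε n) (δ 0 n)
  exact_succ : ∀ p n, Function.Exact (δ p n) (δ (p + 1) n)

/-- The map `∑ (-1)^k (d_k)_*` on Hochschild chains. -/
def hochschildDelta (p n : ℕ) : CC (CechAlgebra P U p) n →ₗ[ℂ] CC (CechAlgebra P U (p + 1)) n :=
  ∑ k : Fin (p + 2), (-1 : ℂ) ^ (k : ℕ) • CC.map (coface P U p k) n

/-- The map `∑ (-1)^k (d_k)_*` on cyclic (`r = 0`) or periodic (`r = ⊤`) chains. -/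
def laurentDelta (r : WithTop ℤ) (p : ℕ) (m : ℤ) :
    LaurentCC (CechAlgebra P U p) r m →ₗ[ℂ] LaurentCC (CechAlgebra P U (p + 1)) r m :=
  ∑ k : Fin (p + 2), (-1 : ℂ) ^ (k : ℕ) • LaurentCC.map (coface P U p k) r m

end Cech

end CechCyclic

end

open CechCyclic

noncomputable section

namespace CechCyclic

/-! Exactness comes from a partition of unity. By compactness there are smooth functions `ρ i` with
support in `U i`, finitely many of which already sum to one. Put `(h s)_{i₀…i_p} = ∑ ρ_i s_{i
i₀…i_p}`, where `ρ_i s_{i i₀…i_p}` is extended by zero from `U_i ∩ U_{i₀…i_p}` to `U_{i₀…i_p}`. On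
the algebras themselves `h` is an extra degeneracy of the augmented cosimplicial diagram of
restriction maps: `h d₀ = id` because the weights sum to one, and `h d_{k+1} = d_k h` term by term
(`homotopy_comp_coface_zero`, `homotopy_comp_coface_succ`, with `homotopyZero` at the augmentation).

The point is to transport this to chains. Tensor powers are not additive functors, so a contraction
of the alternating sum on the algebras would be of no use. But `A ↦ A^{⊗̂ n}`, hence `CC` and
`LaurentCC`, is functorial for all continuous linear maps, multiplicative or not, and the identities
for an extra degeneracy are equations between composites. They therefore survive, and after
application of the functor they give `hδ + δh = id` (`ExactSequenceOfComplexes.of_extraDegeneracy`).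
The map induced by `h` need not commute with `b` or `B`: exactness is only claimed for vector
spaces, degree by degree. The analytic input is the continuity of `h`, which follows from the
Leibniz rule (`exists_jetSeminorm_cutoffLinear_le`).

That the rows are complexes and that `δ` is a chain map is the classical cyclic algebra: `b² = b'² =
0`, `b(1 - λ) = (1 - λ)b'`, `(1 - λ)Q = Q(1 - λ) = 0` and `b'Q = Qb` give `b² = B² = bB + Bb = 0` on
`CC`; restriction maps are multiplicative, so they commute with all these operators. -/

/-- A double alternating sum vanishes if its terms satisfy the simplicial identity. -/
theorem sum_sum_alternating_eq_zero {M : Type*} [AddCommGroup M] [Module ℂ M] {n : ℕ}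
    (F : Fin n → Fin (n + 1) → M) (h : ∀ i j : Fin n, j ≤ i → F i j.castSucc = F j i.succ) :
    ∑ i : Fin n, ∑ j : Fin (n + 1), ((-1 : ℂ) ^ (i : ℕ) * (-1 : ℂ) ^ (j : ℕ)) • F i j = 0 := by
  -- Split the inner sum at `j ≤ i`. In the other half `j` is a successor, which flips the sign.
  -- Once the two indices of that half are exchanged, `h` makes the halves cancel.
  have hsplit : ∀ i : Fin n,
      ∑ j : Fin (n + 1), ((-1 : ℂ) ^ (i : ℕ) * (-1 : ℂ) ^ (j : ℕ)) • F i j =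
        (∑ j : Fin n, if j ≤ i then ((-1 : ℂ) ^ (i : ℕ) * (-1 : ℂ) ^ (j : ℕ)) • F i j.castSucc else 0) +
        ∑ j : Fin n, if i ≤ j then -((-1 : ℂ) ^ (i : ℕ) * (-1 : ℂ) ^ (j : ℕ)) • F i j.succ else 0 := by
    intro i
    have key : ∀ j : Fin (n + 1), ((-1 : ℂ) ^ (i : ℕ) * (-1 : ℂ) ^ (j : ℕ)) • F i j =
        (if (j : ℕ) ≤ i then ((-1 : ℂ) ^ (i : ℕ) * (-1 : ℂ) ^ (j : ℕ)) • F i j else 0) +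
        (if (i : ℕ) < j then ((-1 : ℂ) ^ (i : ℕ) * (-1 : ℂ) ^ (j : ℕ)) • F i j else 0) := by
      intro j
      by_cases hj : (j : ℕ) ≤ i
      · simp [hj]
      · simp [hj, not_le.1 hj]
    rw [Finset.sum_congr rfl fun j _ => key j, Finset.sum_add_distrib, Fin.sum_univ_castSucc,
      Fin.sum_univ_succ (fun j : Fin (n + 1) => if (i : ℕ) < j then
        ((-1 : ℂ) ^ (i : ℕ) * (-1 : ℂ) ^ (j : ℕ)) • F i j else 0)]
    simp only [Fin.val_last, i.isLt.not_ge, if_false, add_zero, Fin.val_zero, Nat.not_lt_zero,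
      zero_add, Fin.val_castSucc, Fin.val_succ, Nat.lt_succ_iff, Fin.val_fin_le, pow_succ, mul_neg,
      mul_one]
  rw [Finset.sum_congr rfl fun i _ => hsplit i, Finset.sum_add_distrib,
    Finset.sum_comm (f := fun i j : Fin n => if i ≤ j then
      -((-1 : ℂ) ^ (i : ℕ) * (-1 : ℂ) ^ (j : ℕ)) • F i j.succ else 0), ← Finset.sum_add_distrib]
  refine Finset.sum_eq_zero fun i _ => ?_
  rw [← Finset.sum_add_distrib]
  refine Finset.sum_eq_zero fun j _ => ?_
  split_ifs with hij
  · rw [h i j hij, ← add_smul, mul_comm]; simp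
  · simp

/-! ### Combinatorics of merging and rotating tuples -/

namespace AlgTensor

variable {A : Type*} [NonUnitalRing A]

/-- The two merges overlap only when `i = j`, and there the identity is associativity of three
consecutive factors. -/
theorem mergeAt_mergeAt {n : ℕ} {i j : Fin n} (hij : j ≤ i) (v : Fin (n + 2) → A) :
    mergeAt i (mergeAt j.castSucc v) = mergeAt j (mergeAt i.succ v) := by
  ext k
  obtain ⟨i, hi⟩ := i
  obtain ⟨j, hj⟩ := j
  obtain ⟨k, hk⟩ := k
  simp only [mergeAt, Fin.lt_def, Fin.ext_iff, Fin.le_def, Fin.castSucc_mk, Fin.succ_mk] at hij ⊢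
  split_ifs <;> first | rfl | omega | rw [mul_assoc]

theorem finRotate_symm_zero (n : ℕ) : (finRotate (n + 1)).symm 0 = Fin.last n := by
  rw [Equiv.symm_apply_eq, finRotate_last]

theorem finRotate_symm_succ {n : ℕ} (i : Fin n) :
    (finRotate (n + 1)).symm i.succ = i.castSucc := by
  rw [Equiv.symm_apply_eq, finRotate_apply, Fin.coeSucc_eq_succ]

/-- Rotation moves every entry but the last one place to the right, so a merged pair that avoids the
last entry just has its position raised by one. -/
theorem mergeAt_rotate {n : ℕ} (j : Fin n) (v : Fin (n + 2) → A) :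
    (fun i => mergeAt j.castSucc v ((finRotate (n + 1)).symm i)) =
      mergeAt j.succ fun i => v ((finRotate (n + 2)).symm i) := by
  ext i
  refine Fin.cases ?_ (fun i => ?_) i
  · simp only [mergeAt, finRotate_symm_zero, Fin.castSucc_zero, Fin.succ_pos, if_true]
    rw [if_neg, if_neg, Fin.succ_last]
    · exact (Fin.castSucc_lt_last j).ne'
    · exact (Fin.castSucc_lt_last j).le.not_gt
  · simp only [mergeAt, finRotate_symm_succ, Fin.succ_lt_succ_iff, Fin.succ_inj,
      Fin.castSucc_lt_castSucc_iff, Fin.castSucc_inj, ← Fin.succ_castSucc]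

/-- The pair formed by the last two entries reaches the front in one rotation when it is already
merged, but in two when it is not. -/
theorem mergeAt_last_rotate {n : ℕ} (v : Fin (n + 2) → A) :
    (fun i => mergeAt (Fin.last n) v ((finRotate (n + 1)).symm i)) =
      mergeAt 0 fun i => v ((finRotate (n + 2)).symm ((finRotate (n + 2)).symm i)) := by
  ext i
  refine Fin.cases ?_ (fun i => ?_) i
  · simp only [mergeAt, finRotate_symm_zero, Fin.castSucc_zero, lt_irrefl, if_false, if_true,
      finRotate_symm_succ]
    rw [← Fin.succ_last n, finRotate_symm_succ]
  · simp only [mergeAt, finRotate_symm_succ, Fin.castSucc_lt_last, if_true, Fin.not_lt_zero,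
      if_false, Fin.succ_ne_zero, ← Fin.succ_castSucc]

end AlgTensor

/-! ### Operators on completed tensor powers: cyclic permutation and norm operator -/

namespace ProjTensor

section Linear

variable {A : Type*} [NonUnitalRing A] [Module ℂ A] [TopologicalSpace A]

/-- Elementary tensors in the completed tensor power. -/
def tprod {n : ℕ} (v : Fin n → A) : ProjTensor A n := ((AlgTensor.tprod v : AlgTensor A n) :)

/-- Elementary tensors span a dense subspace of the completion. The basic relations between faces,
rotations and induced maps are all checked on them. -/
theorem hom_ext {Y : Type*} [AddCommGroup Y] [Module ℂ Y] [TopologicalSpace Y] [T2Space Y]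
    {n : ℕ} {f g : ProjTensor A n →L[ℂ] Y} (h : ∀ v, f (tprod v) = g (tprod v)) : f = g := by
  refine ContinuousLinearMap.ext fun x => ?_
  refine congrFun (UniformSpace.Completion.ext f.continuous g.continuous fun z => ?_) x
  -- The inclusion is stated on the bare tensor product, so that extensionality through multilinear
  -- maps applies.
  let incl : (⨂[ℂ] _ : Fin n, A) →ₗ[ℂ] ProjTensor A n :=
    { toFun := fun z => ((show AlgTensor A n from z : AlgTensor A n) : ProjTensor A n)
      map_add' := fun x y => UniformSpace.Completion.coe_add (α := AlgTensor A n) x y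
      map_smul' := fun c x => UniformSpace.Completion.coe_smul (X := AlgTensor A n) c x }
  have : f.toLinearMap ∘ₗ incl = g.toLinearMap ∘ₗ incl :=
    PiTensorProduct.ext (MultilinearMap.ext h)
  exact LinearMap.congr_fun this z

variable (A) in
/-- The cyclic permutation `v₀ ⊗ ⋯ ⊗ vₙ₋₁ ↦ vₙ₋₁ ⊗ v₀ ⊗ ⋯ ⊗ vₙ₋₂`. -/
def rotate (n : ℕ) : ProjTensor A n →L[ℂ] ProjTensor A n := (AlgTensor.rotate A n).completion

theorem rotate_tprod {n : ℕ} (v : Fin n → A) :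
    rotate A n (tprod v) = tprod fun i => v ((finRotate n).symm i) := by
  rw [rotate, tprod, ContinuousLinearMap.completion_apply_coe, AlgTensor.rotate_tprod, tprod]

theorem lam_succ (n : ℕ) : lam A (n + 1) = (-1 : ℂ) ^ n • rotate A (n + 1) := rfl

theorem rotate_pow_tprod {n : ℕ} (k : ℕ) (v : Fin n → A) :
    (rotate A n ^ k) (tprod v) = tprod fun i => v (((finRotate n).symm ^ k) i) := by
  induction k generalizing v with
  | zero => simp
  | succ k ih =>
    rw [pow_succ, ContinuousLinearMap.mul_def, ContinuousLinearMap.comp_apply, rotate_tprod, ih]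
    simp [pow_succ']

/-- On at least two letters the rotation is a single cycle of full length, which gives its order; on
fewer letters there is only one permutation. -/
theorem finRotate_symm_pow_self : ∀ n : ℕ, (finRotate n).symm ^ n = 1
  | 0 => Subsingleton.elim _ _
  | 1 => Subsingleton.elim _ _
  | n + 2 => by
    rw [← Equiv.Perm.inv_def, inv_pow, inv_eq_one, ← orderOf_dvd_iff_pow_eq_one,
      ← Equiv.Perm.lcm_cycleType, cycleType_finRotate]
    simp

theorem lam_pow_self (n : ℕ) : lam A (n + 1) ^ (n + 1) = 1 := by
  have h : rotate A (n + 1) ^ (n + 1) = 1 := hom_ext fun v => by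
    rw [rotate_pow_tprod, finRotate_symm_pow_self]; rfl
  -- The accumulated sign is `(-1)^(n(n+1))`, and `n(n+1)` is even.
  rw [lam_succ, smul_pow, h, ← pow_mul, (Nat.even_mul_succ_self n).neg_one_pow, one_smul]

/-- As `λ` has finite order, multiplication by it permutes the summands of `Q` cyclically; this is
`(1 - λ)Q = 0`. -/
theorem lam_mul_Q (n : ℕ) : lam A (n + 1) * Q A (n + 1) = Q A (n + 1) := by
  rw [Q, Finset.mul_sum]
  simp only [← pow_succ']
  rw [Finset.sum_range_succ, lam_pow_self, Finset.sum_range_succ' (fun j => lam A (n + 1) ^ j),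
    pow_zero]

theorem Q_mul_lam (n : ℕ) : Q A (n + 1) * lam A (n + 1) = Q A (n + 1) := by
  rw [Q, Finset.sum_mul]
  simp only [← pow_succ]
  rw [Finset.sum_range_succ, lam_pow_self, Finset.sum_range_succ' (fun j => lam A (n + 1) ^ j),
    pow_zero]

theorem lam_Q_apply (n : ℕ) (x : ProjTensor A (n + 1)) :
    lam A (n + 1) (Q A (n + 1) x) = Q A (n + 1) x :=
  DFunLike.congr_fun (lam_mul_Q n) x

theorem Q_lam_apply (n : ℕ) (x : ProjTensor A (n + 1)) :
    Q A (n + 1) (lam A (n + 1) x) = Q A (n + 1) x :=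
  DFunLike.congr_fun (Q_mul_lam n) x

theorem lam_pow_add_apply (n i j : ℕ) (x : ProjTensor A n) :
    (lam A n ^ (i + j)) x = (lam A n ^ i) ((lam A n ^ j) x) := by
  rw [pow_add, ContinuousLinearMap.mul_def, ContinuousLinearMap.comp_apply]

theorem lam_pow_succ_apply (n j : ℕ) (x : ProjTensor A n) :
    (lam A n ^ (j + 1)) x = lam A n ((lam A n ^ j) x) := by
  rw [add_comm, lam_pow_add_apply, pow_one]

theorem lam_pow_succ_apply' (n j : ℕ) (x : ProjTensor A n) :
    (lam A n ^ (j + 1)) x = (lam A n ^ j) (lam A n x) := by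
  rw [lam_pow_add_apply, pow_one]

theorem lam_pow_Q (n j : ℕ) (x : ProjTensor A (n + 1)) :
    (lam A (n + 1) ^ j) (Q A (n + 1) x) = Q A (n + 1) x := by
  induction j with
  | zero => rfl
  | succ j ih => rw [lam_pow_succ_apply, ih, lam_Q_apply]

theorem Q_lam_pow (n j : ℕ) (x : ProjTensor A (n + 1)) :
    Q A (n + 1) ((lam A (n + 1) ^ j) x) = Q A (n + 1) x := by
  induction j with
  | zero => rfl
  | succ j ih => rw [lam_pow_succ_apply, Q_lam_apply, ih]

section Map

variable {B : Type*} [NonUnitalRing B] [Module ℂ B] [TopologicalSpace B]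
  {C : Type*} [NonUnitalRing C] [Module ℂ C] [TopologicalSpace C]

theorem map_tprod (φ : A →L[ℂ] B) {n : ℕ} (v : Fin n → A) :
    map φ n (tprod v) = tprod fun i => φ (v i) := by
  rw [map, tprod, ContinuousLinearMap.completion_apply_coe, AlgTensor.map_tprod, tprod]

theorem map_id (n : ℕ) : map (ContinuousLinearMap.id ℂ A) n = ContinuousLinearMap.id ℂ _ :=
  hom_ext fun v => by rw [map_tprod]; rfl

/-- Functoriality holds for maps that are merely linear and continuous. This is what allows the
non-multiplicative extra degeneracy to act on chains. -/
theorem map_comp (ψ : B →L[ℂ] C) (φ : A →L[ℂ] B) (n : ℕ) :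
    map (ψ ∘L φ) n = map ψ n ∘L map φ n :=
  hom_ext fun v => by simp only [map_tprod, ContinuousLinearMap.comp_apply]

theorem map_comp_lam (φ : A →L[ℂ] B) : ∀ n, map φ n ∘L lam A n = lam B n ∘L map φ n
  | 0 => rfl
  | n + 1 => hom_ext fun v => by
    simp only [lam_succ, ContinuousLinearMap.comp_apply, smul_apply, map_smul,
      rotate_tprod, map_tprod]

theorem map_lam (φ : A →L[ℂ] B) (n : ℕ) (x : ProjTensor A n) :
    map φ n (lam A n x) = lam B n (map φ n x) :=
  DFunLike.congr_fun (map_comp_lam φ n) x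

theorem map_Q (φ : A →L[ℂ] B) (n : ℕ) (x : ProjTensor A n) :
    map φ n (Q A n x) = Q B n (map φ n x) := by
  have h : ∀ (j : ℕ) x, map φ n ((lam A n ^ j) x) = (lam B n ^ j) (map φ n x) := by
    intro j
    induction j with
    | zero => intro x; rfl
    | succ j ih => intro x; rw [lam_pow_succ_apply, lam_pow_succ_apply, map_lam, ih]
  simp only [Q, sum_apply, map_sum, h]

end Map

end Linear

/-! ### Face maps and the relations between `b`, `b'`, `λ` and `Q` -/

variable {A : Type*} [NonUnitalRing A] [Module ℂ A] [IsScalarTower ℂ A A] [SMulCommClass ℂ A A]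
  [TopologicalSpace A] [PolynormableSpace ℂ A] [ContinuousMul A]

theorem face_tprod {n : ℕ} (j : Fin n) (v : Fin (n + 1) → A) :
    face A j (tprod v) = tprod (AlgTensor.mergeAt j v) := by
  rw [face, tprod, ContinuousLinearMap.completion_apply_coe, AlgTensor.face_tprod, tprod]

theorem face_comp_face {n : ℕ} {i j : Fin n} (hij : j ≤ i) :
    face A i ∘L face A j.castSucc = face A j ∘L face A i.succ :=
  hom_ext fun v => by
    simp only [ContinuousLinearMap.comp_apply, face_tprod, AlgTensor.mergeAt_mergeAt hij]

theorem rotate_comp_face {n : ℕ} (j : Fin n) :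
    rotate A (n + 1) ∘L face A j.castSucc = face A j.succ ∘L rotate A (n + 2) :=
  hom_ext fun v => by
    simp only [ContinuousLinearMap.comp_apply, face_tprod, rotate_tprod, AlgTensor.mergeAt_rotate]

theorem rotate_comp_face_last (n : ℕ) :
    rotate A (n + 1) ∘L face A (Fin.last n) =
      face A 0 ∘L rotate A (n + 2) ∘L rotate A (n + 2) :=
  hom_ext fun v => by
    simp only [ContinuousLinearMap.comp_apply, face_tprod, rotate_tprod,
      AlgTensor.mergeAt_last_rotate]

theorem face_face {n : ℕ} {i j : Fin n} (hij : j ≤ i) (x : ProjTensor A (n + 2)) :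
    face A i (face A j.castSucc x) = face A j (face A i.succ x) :=
  DFunLike.congr_fun (face_comp_face hij) x

theorem rotate_face {n : ℕ} (j : Fin n) (x : ProjTensor A (n + 2)) :
    rotate A (n + 1) (face A j.castSucc x) = face A j.succ (rotate A (n + 2) x) :=
  DFunLike.congr_fun (rotate_comp_face j) x

theorem rotate_face_last (n : ℕ) (x : ProjTensor A (n + 2)) :
    rotate A (n + 1) (face A (Fin.last n) x) =
      face A 0 (rotate A (n + 2) (rotate A (n + 2) x)) :=
  DFunLike.congr_fun (rotate_comp_face_last n) x

theorem bar_apply (n : ℕ) (x : ProjTensor A (n + 1)) :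
    bar A n x = ∑ j : Fin n, (-1 : ℂ) ^ (j : ℕ) • face A j x := by
  simp [bar]

theorem bar_bar (n : ℕ) (x : ProjTensor A (n + 2)) : bar A n (bar A (n + 1) x) = 0 := by
  rw [bar_apply n]
  simp only [bar_apply (n + 1), map_sum, map_smul, Finset.smul_sum, smul_smul]
  exact sum_sum_alternating_eq_zero (fun i j => face A i (face A j x)) fun i j hij =>
    face_face hij x

variable (A) in
/-- The face maps of the cyclic bar construction: the ordinary ones and, as the last one,
`v₀ ⊗ ⋯ ⊗ vₙ₊₁ ↦ vₙ₊₁ v₀ ⊗ v₁ ⊗ ⋯ ⊗ vₙ`. -/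
def cyclicFace {n : ℕ} (j : Fin (n + 2)) : ProjTensor A (n + 2) →L[ℂ] ProjTensor A (n + 1) :=
  Fin.lastCases (motive := fun _ => ProjTensor A (n + 2) →L[ℂ] ProjTensor A (n + 1))
    (face A 0 ∘L rotate A (n + 2)) (fun j => face A j) j

theorem cyclicFace_last (n : ℕ) (x : ProjTensor A (n + 2)) :
    cyclicFace A (Fin.last (n + 1)) x = face A 0 (rotate A (n + 2) x) := by
  simp [cyclicFace]

theorem cyclicFace_castSucc {n : ℕ} (j : Fin (n + 1)) :
    cyclicFace A j.castSucc = face A j := by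
  simp [cyclicFace]

theorem b_apply (n : ℕ) (x : ProjTensor A (n + 2)) :
    b A n x = bar A (n + 1) x + face A 0 (lam A (n + 2) x) := rfl

/-- The wrap-around summand of `b` becomes one more face: the sign `(-1)^(n+1)` of `λ` on `n + 2`
factors is the sign due to face number `n + 1`. Thus `b² = 0` needs only the simplicial identity. -/
theorem b_apply_eq_sum (n : ℕ) (x : ProjTensor A (n + 2)) :
    b A n x = ∑ j : Fin (n + 2), (-1 : ℂ) ^ (j : ℕ) • cyclicFace A j x := by
  rw [Fin.sum_univ_castSucc, b_apply, bar_apply, lam_succ, cyclicFace_last]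
  simp [cyclicFace_castSucc]

/-- Away from the wrap-around face this is associativity. Otherwise all rotations are moved to the
right, past the faces, by `rotate_face` and `rotate_face_last`, and the remaining identity is again
one between ordinary faces. -/
theorem cyclicFace_cyclicFace {n : ℕ} {i j : Fin (n + 2)} (hij : j ≤ i)
    (x : ProjTensor A (n + 3)) :
    cyclicFace A i (cyclicFace A j.castSucc x) = cyclicFace A j (cyclicFace A i.succ x) := by
  rw [cyclicFace_castSucc]
  induction i using Fin.lastCases with
  | last =>
    rw [cyclicFace_last, Fin.succ_last, cyclicFace_last]
    induction j using Fin.lastCases with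
    | last =>
      rw [cyclicFace_last, rotate_face_last, ← Fin.castSucc_zero (n := n + 1),
        rotate_face, Fin.castSucc_zero, ← Fin.castSucc_zero (n := n + 1), face_face le_rfl]
    | cast j =>
      rw [cyclicFace_castSucc, rotate_face, ← Fin.castSucc_zero (n := n + 1),
        face_face (Fin.zero_le j)]
  | cast i =>
    obtain ⟨j, rfl⟩ : ∃ j' : Fin (n + 1), j = j'.castSucc :=
      ⟨j.castPred (Fin.ne_last_of_lt (hij.trans_lt (Fin.castSucc_lt_last i))), by simp⟩
    rw [Fin.succ_castSucc, cyclicFace_castSucc, cyclicFace_castSucc, cyclicFace_castSucc,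
      face_face (by simpa using hij)]

theorem b_b (n : ℕ) (x : ProjTensor A (n + 3)) : b A n (b A (n + 1) x) = 0 := by
  rw [b_apply_eq_sum n]
  simp only [b_apply_eq_sum (n + 1), map_sum, map_smul, Finset.smul_sum, smul_smul]
  exact sum_sum_alternating_eq_zero (fun i j => cyclicFace A i (cyclicFace A j x)) fun i j hij =>
    cyclicFace_cyclicFace hij x

variable (A) in
/-- The face map with its sign. -/
def signedFace {n : ℕ} (j : Fin n) : ProjTensor A (n + 1) →L[ℂ] ProjTensor A n :=
  (-1 : ℂ) ^ (j : ℕ) • face A j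

/-- The signs of `λ` on `n + 1` and on `n + 2` factors differ by `-1`, as do those of neighbouring
faces; absorbed into the faces, the signs drop out of the relation. -/
theorem lam_signedFace {n : ℕ} (j : Fin n) (x : ProjTensor A (n + 2)) :
    lam A (n + 1) (signedFace A j.castSucc x) = signedFace A j.succ (lam A (n + 2) x) := by
  simp only [signedFace, lam_succ, smul_apply, map_smul, rotate_face, smul_smul]
  congr 1
  simp only [Fin.val_castSucc, Fin.val_succ]; ring

theorem lam_signedFace_last (n : ℕ) (x : ProjTensor A (n + 2)) :
    lam A (n + 1) (signedFace A (Fin.last n) x) = face A 0 (lam A (n + 2) (lam A (n + 2) x)) := by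
  simp only [signedFace, lam_succ, smul_apply, map_smul, rotate_face_last, smul_smul]
  congr 1
  simp only [Fin.val_last, ← pow_add]
  rw [show n + 1 + (n + 1) = (n + n) + 2 by ring, pow_add _ (n + n) 2]; norm_num

theorem bar_eq_sum (n : ℕ) (x : ProjTensor A (n + 1)) : bar A n x = ∑ j, signedFace A j x := by
  rw [bar_apply]; rfl

/-- `λ` carries the signed faces of `b'` to their successors, composed with `λ`. So `λb'` and `b'λ`
differ only at the two ends, and the wrap-around terms of `b` and `bλ` account for exactly this
difference. -/
theorem b_one_sub_lam (n : ℕ) (x : ProjTensor A (n + 2)) :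
    b A n (x - lam A (n + 2) x) = bar A (n + 1) x - lam A (n + 1) (bar A (n + 1) x) := by
  -- After the shift, face zero is missing, hence the subtraction; the last face has become face
  -- zero preceded by `λ²`.
  have h : lam A (n + 1) (bar A (n + 1) x) = bar A (n + 1) (lam A (n + 2) x) -
      face A 0 (lam A (n + 2) x) + face A 0 (lam A (n + 2) (lam A (n + 2) x)) := by
    rw [bar_eq_sum, map_sum, Fin.sum_univ_castSucc, lam_signedFace_last, bar_eq_sum,
      Fin.sum_univ_succ (n := n)]
    simp only [lam_signedFace]
    congr 1
    simp [signedFace]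
  rw [h, b_apply]
  simp only [map_sub]
  abel

/-- Iterating the shift shows that every signed face is face zero conjugated by a power of `λ`, with
different numbers of factors on the two sides. -/
theorem lam_pow_face_zero {n : ℕ} (j : ℕ) (hj : j < n + 1) (x : ProjTensor A (n + 2)) :
    (lam A (n + 1) ^ j) (face A 0 x) =
      signedFace A (⟨j, hj⟩ : Fin (n + 1)) ((lam A (n + 2) ^ j) x) := by
  induction j with
  | zero => simp [signedFace]
  | succ j ih =>
    rw [lam_pow_succ_apply, lam_pow_succ_apply, ih (by omega)]
    exact lam_signedFace ⟨j, by omega⟩ _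

/-- In `λʲ ∘ face₀ = signedFaceⱼ ∘ λʲ` the inner `Q` absorbs the right-hand `λʲ`; summed over `j`,
the left-hand powers form the outer `Q`. -/
theorem bar_Q (n : ℕ) (x : ProjTensor A (n + 2)) :
    bar A (n + 1) (Q A (n + 2) x) = Q A (n + 1) (face A 0 (Q A (n + 2) x)) := by
  rw [bar_eq_sum, Q.eq_def A (n + 1), sum_apply, ← Fin.sum_univ_eq_sum_range
    (fun j => (lam A (n + 1) ^ j) (face A 0 (Q A (n + 2) x)))]
  refine Finset.sum_congr rfl fun j _ => ?_
  rw [lam_pow_face_zero j j.2, lam_pow_Q]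

/-- Mirror image of `bar_Q`: now the outer `Q` absorbs the powers of `λ` on the left of face zero,
and those on its right add up to the inner `Q`. -/
theorem Q_b (n : ℕ) (x : ProjTensor A (n + 2)) :
    Q A (n + 1) (b A n x) = Q A (n + 1) (face A 0 (Q A (n + 2) x)) := by
  have h : ∀ j : Fin (n + 1), Q A (n + 1) (signedFace A j x) =
      Q A (n + 1) (face A 0 ((lam A (n + 2) ^ (n + 2 - j : ℕ)) x)) := fun j => by
    rw [← Q_lam_pow n j (face A 0 _), lam_pow_face_zero j j.2, ← lam_pow_add_apply,
      Nat.add_sub_cancel' (by omega), lam_pow_self]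
    rfl
  -- The faces of `b'` supply the exponents `n + 2 - j`, that is `2, …, n + 2`, and the wrap-around
  -- term supplies the exponent `1`: together one full period of `λ`.
  have hQ : Q A (n + 2) x = (∑ j : Fin (n + 1), (lam A (n + 2) ^ (n + 2 - j : ℕ)) x) +
      lam A (n + 2) x := by
    rw [← Q_lam_apply, Q, sum_apply, Finset.sum_range_succ',
      Fin.sum_univ_eq_sum_range (fun j => (lam A (n + 2) ^ (n + 2 - j : ℕ)) x),
      ← Finset.sum_range_reflect]
    congr 1
    refine Finset.sum_congr rfl fun j hj => ?_
    have := Finset.mem_range.1 hj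
    rw [show n + 2 - j = n + 1 - 1 - j + 1 + 1 by omega, lam_pow_succ_apply', lam_pow_succ_apply',
      lam_pow_succ_apply']
  rw [b_apply, bar_eq_sum, map_add, map_sum, hQ]
  simp only [map_add, map_sum, h]

/-- Both sides equal `Q ∘ face₀ ∘ Q`. This is the relation behind `bB + Bb = 0`. -/
theorem Q_b_eq_bar_Q (n : ℕ) (x : ProjTensor A (n + 2)) :
    Q A (n + 1) (b A n x) = bar A (n + 1) (Q A (n + 2) x) := by
  rw [Q_b, bar_Q]

section Map

variable {B : Type*} [NonUnitalRing B] [Module ℂ B] [IsScalarTower ℂ B B] [SMulCommClass ℂ B B]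
  [TopologicalSpace B] [PolynormableSpace ℂ B] [ContinuousMul B]

/-- Multiplicativity enters only here, at the merged entry; it is available for the restriction
maps. -/
theorem map_face (φ : A →L[ℂ] B) (hφ : ∀ x y, φ (x * y) = φ x * φ y) {n : ℕ} (j : Fin n)
    (x : ProjTensor A (n + 1)) : map φ n (face A j x) = face B j (map φ (n + 1) x) := by
  have : map φ n ∘L face A j = face B j ∘L map φ (n + 1) := hom_ext fun v => by
    simp only [ContinuousLinearMap.comp_apply, face_tprod, map_tprod]
    congr 1
    ext i
    simp only [AlgTensor.mergeAt]
    split_ifs <;> simp only [hφ]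
  exact DFunLike.congr_fun this x

theorem map_bar (φ : A →L[ℂ] B) (hφ : ∀ x y, φ (x * y) = φ x * φ y) (n : ℕ)
    (x : ProjTensor A (n + 1)) : map φ n (bar A n x) = bar B n (map φ (n + 1) x) := by
  simp only [bar_apply, map_sum, map_smul, map_face φ hφ]

theorem map_b (φ : A →L[ℂ] B) (hφ : ∀ x y, φ (x * y) = φ x * φ y) (n : ℕ)
    (x : ProjTensor A (n + 2)) : map φ (n + 1) (b A n x) = b B n (map φ (n + 2) x) := by
  simp only [b_apply, map_add, map_bar φ hφ, map_face φ hφ, map_lam]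

end Map

end ProjTensor

/-! ### Hochschild chains: `b² = 0`, `B² = 0`, `bB + Bb = 0`, naturality -/

namespace CC

section Linear

variable {A : Type*} [NonUnitalRing A] [Module ℂ A] [TopologicalSpace A]
  {A' : Type*} [NonUnitalRing A'] [Module ℂ A'] [TopologicalSpace A']
  {A'' : Type*} [NonUnitalRing A''] [Module ℂ A''] [TopologicalSpace A'']

theorem map_zero_apply (φ : A →L[ℂ] A') (x : CC A 0) :
    map φ 0 x = (ProjTensor.map φ 1 x : ProjTensor A' 1) := rfl

theorem map_succ_apply (φ : A →L[ℂ] A') (k : ℕ) (x : CC A (k + 1)) :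
    map φ (k + 1) x = (ProjTensor.map φ (k + 2) x.1, ProjTensor.map φ (k + 1) x.2) := rfl

theorem B_zero_apply (x : CC A 0) :
    B A 0 x = ((0 : ProjTensor A 2), (ProjTensor.Q A 1 x : ProjTensor A 1)) := rfl

theorem B_succ_apply (k : ℕ) (x : CC A (k + 1)) :
    B A (k + 1) x = ((0 : ProjTensor A (k + 3)), ProjTensor.Q A (k + 2) x.1) := rfl

theorem map_id : ∀ k, map (ContinuousLinearMap.id ℂ A) k = LinearMap.id
  | 0 => LinearMap.ext fun x => by
    rw [map_zero_apply, ProjTensor.map_id]; rfl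
  | k + 1 => LinearMap.ext fun x => by
    rw [map_succ_apply, ProjTensor.map_id, ProjTensor.map_id]; rfl

theorem map_comp (ψ : A' →L[ℂ] A'') (φ : A →L[ℂ] A') :
    ∀ k, map (ψ ∘L φ) k = map ψ k ∘ₗ map φ k
  | 0 => LinearMap.ext fun x => by
    rw [map_zero_apply, ProjTensor.map_comp]; rfl
  | k + 1 => LinearMap.ext fun x => by
    rw [map_succ_apply, ProjTensor.map_comp, ProjTensor.map_comp]; rfl

theorem map_B (φ : A →L[ℂ] A') : ∀ k x, map φ (k + 1) (B A k x) = B A' k (map φ k x)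
  | 0, x => Prod.ext (map_zero (ProjTensor.map φ 2)) (ProjTensor.map_Q φ 1 x)
  | k + 1, x => Prod.ext (map_zero (ProjTensor.map φ (k + 3))) (ProjTensor.map_Q φ (k + 2) x.1)

/-- `B` reads the first entry of a pair and writes only into the second. -/
theorem B_B : ∀ k (x : CC A k), B A (k + 1) (B A k x) = 0
  | 0, x => by rw [B_succ_apply, B_zero_apply, map_zero]; rfl
  | k + 1, x => by rw [B_succ_apply, B_succ_apply, map_zero]; rfl

end Linear

variable {A : Type*} [NonUnitalRing A] [Module ℂ A] [IsScalarTower ℂ A A] [SMulCommClass ℂ A A]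
  [TopologicalSpace A] [PolynormableSpace ℂ A] [ContinuousMul A]
  {A' : Type*} [NonUnitalRing A'] [Module ℂ A'] [IsScalarTower ℂ A' A'] [SMulCommClass ℂ A' A']
  [TopologicalSpace A'] [PolynormableSpace ℂ A'] [ContinuousMul A']

theorem b_zero_apply (x : CC A 1) :
    b A 0 x = (ProjTensor.b A 0 x.1 + (x.2 - ProjTensor.lam A 1 x.2) : ProjTensor A 1) := rfl

theorem b_succ_apply (k : ℕ) (x : CC A (k + 2)) :
    b A (k + 1) x = (ProjTensor.b A (k + 1) x.1 + (x.2 - ProjTensor.lam A (k + 2) x.2),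
      -ProjTensor.bar A (k + 1) x.2) := rfl

/-- By `b(1 - λ) = (1 - λ)b'`, the minus sign on `b'` in the second entry of the differential is
what cancels the mixed terms. -/
theorem b_b_fst (n : ℕ) (x : ProjTensor A (n + 3)) (y : ProjTensor A (n + 2)) :
    ProjTensor.b A n (ProjTensor.b A (n + 1) x + (y - ProjTensor.lam A (n + 2) y)) +
      (-ProjTensor.bar A (n + 1) y - ProjTensor.lam A (n + 1) (-ProjTensor.bar A (n + 1) y)) =
      0 := by
  rw [map_add, map_neg, ProjTensor.b_b, ProjTensor.b_one_sub_lam]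
  abel

theorem b_b : ∀ k (x : CC A (k + 2)), b A k (b A (k + 1) x) = 0
  | 0, x => b_b_fst 0 x.1 x.2
  | k + 1, x => Prod.ext (b_b_fst (k + 1) x.1 x.2) <| by
    change -ProjTensor.bar A (k + 1) (-ProjTensor.bar A (k + 2) x.2) = 0
    rw [map_neg, ProjTensor.bar_bar, neg_zero, neg_zero]

/-- In degree zero there is no `Bb` term to compensate; `bB` vanishes by itself because `(1 - λ)Q =
0`. -/
theorem b_B_zero (x : CC A 0) : b A 0 (B A 0 x) = 0 := by
  let y : ProjTensor A 1 := x
  change ProjTensor.b A 0 0 + (ProjTensor.Q A 1 y - ProjTensor.lam A 1 (ProjTensor.Q A 1 y)) = 0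
  rw [map_zero, ProjTensor.lam_Q_apply, sub_self, add_zero]

/-- The first entry is `(1 - λ)Q = 0`. In the second, `Q(1 - λ) = 0` removes the contribution of
`y`, leaving `-b'Q + Qb = 0`. -/
theorem b_B_add_B_b : ∀ k (x : CC A (k + 1)), b A (k + 1) (B A (k + 1) x) + B A k (b A k x) = 0
  | 0, x => by
    rw [b_succ_apply, B_succ_apply, B_zero_apply, b_zero_apply]
    simp only [map_zero, ProjTensor.lam_Q_apply, sub_self, add_zero, map_add, map_sub,
      ProjTensor.Q_lam_apply, ProjTensor.Q_b_eq_bar_Q]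
    exact Prod.ext (add_zero 0) (neg_add_cancel _)
  | k + 1, x => by
    rw [b_succ_apply, B_succ_apply, B_succ_apply, b_succ_apply]
    simp only [map_zero, ProjTensor.lam_Q_apply, sub_self, add_zero, map_add, map_sub,
      ProjTensor.Q_lam_apply, ProjTensor.Q_b_eq_bar_Q]
    exact Prod.ext (add_zero 0) (neg_add_cancel _)

theorem map_b_fst (φ : A →L[ℂ] A') (hφ : ∀ x y, φ (x * y) = φ x * φ y) (n : ℕ)
    (x : ProjTensor A (n + 2)) (y : ProjTensor A (n + 1)) :
    ProjTensor.map φ (n + 1) (ProjTensor.b A n x + (y - ProjTensor.lam A (n + 1) y)) =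
      ProjTensor.b A' n (ProjTensor.map φ (n + 2) x) + (ProjTensor.map φ (n + 1) y -
        ProjTensor.lam A' (n + 1) (ProjTensor.map φ (n + 1) y)) := by
  simp only [map_add, map_sub, ProjTensor.map_b φ hφ, ProjTensor.map_lam]

theorem map_b (φ : A →L[ℂ] A') (hφ : ∀ x y, φ (x * y) = φ x * φ y) :
    ∀ k x, map φ k (b A k x) = b A' k (map φ (k + 1) x)
  | 0, x => map_b_fst φ hφ 0 x.1 x.2
  | k + 1, x => Prod.ext (map_b_fst φ hφ (k + 1) x.1 x.2) <|
      (map_neg (ProjTensor.map φ (k + 1)) _).trans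
        (congrArg Neg.neg (ProjTensor.map_bar φ hφ (k + 1) x.2))

end CC

/-! ### Cyclic and periodic chains: the differential `b + uB` -/

namespace LaurentCC

section Linear

variable {A : Type*} [NonUnitalRing A] [Module ℂ A] [TopologicalSpace A]
  {A' : Type*} [NonUnitalRing A'] [Module ℂ A'] [TopologicalSpace A']
  {A'' : Type*} [NonUnitalRing A''] [Module ℂ A''] [TopologicalSpace A'']

theorem map_id (r : WithTop ℤ) (m : ℤ) :
    map (ContinuousLinearMap.id ℂ A) r m = LinearMap.id :=
  LinearMap.ext fun c => funext fun x => LinearMap.congr_fun (CC.map_id x.1.1) (c x)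

theorem map_comp (ψ : A' →L[ℂ] A'') (φ : A →L[ℂ] A') (r : WithTop ℤ) (m : ℤ) :
    map (ψ ∘L φ) r m = map ψ r m ∘ₗ map φ r m :=
  LinearMap.ext fun c => funext fun x => LinearMap.congr_fun (CC.map_comp ψ φ x.1.1) (c x)

end Linear

variable {A : Type*} [NonUnitalRing A] [Module ℂ A] [IsScalarTower ℂ A A] [SMulCommClass ℂ A A]
  [TopologicalSpace A] [PolynormableSpace ℂ A] [ContinuousMul A]
  {A' : Type*} [NonUnitalRing A'] [Module ℂ A'] [IsScalarTower ℂ A' A'] [SMulCommClass ℂ A' A']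
  [TopologicalSpace A'] [PolynormableSpace ℂ A'] [ContinuousMul A']

theorem d_zero_apply (r : WithTop ℤ) (m : ℤ) (c : LaurentCC A r (m + 1)) (q : ℤ)
    (h : ((0 : ℕ) : ℤ) - 2 * q = m ∧ (q : WithTop ℤ) ≤ r)
    (h₁ : ((1 : ℕ) : ℤ) - 2 * q = m + 1 ∧ (q : WithTop ℤ) ≤ r) :
    d A r m c ⟨(0, q), h⟩ = CC.b A 0 (c ⟨(1, q), h₁⟩) := add_zero _

theorem d_succ_apply (r : WithTop ℤ) (m : ℤ) (c : LaurentCC A r (m + 1)) (k : ℕ) (q : ℤ)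
    (h : ((k + 1 : ℕ) : ℤ) - 2 * q = m ∧ (q : WithTop ℤ) ≤ r)
    (h₁ : ((k + 2 : ℕ) : ℤ) - 2 * q = m + 1 ∧ (q : WithTop ℤ) ≤ r)
    (h₂ : (k : ℤ) - 2 * (q - 1) = m + 1 ∧ ((q - 1 : ℤ) : WithTop ℤ) ≤ r) :
    d A r m c ⟨(k + 1, q), h⟩ =
      CC.b A (k + 1) (c ⟨(k + 2, q), h₁⟩) + CC.B A k (c ⟨(k, q - 1), h₂⟩) := rfl

/-- The coefficient of `u^q` in `uBc` comes from `u^(q-1)`, an exponent that a truncation `q ≤ r`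
retains whenever it retains `q`. -/
theorem sub_one_le {q : ℤ} {r : WithTop ℤ} (h : (q : WithTop ℤ) ≤ r) :
    ((q - 1 : ℤ) : WithTop ℤ) ≤ r :=
  le_trans (by exact_mod_cast (by omega : q - 1 ≤ q)) h

/-- The square is `b² + u(bB + Bb) + u²B²`. Its component in `CC_k` draws on the chain degrees `k +
2`, `k` and `k - 2`, so the cases `k = 0, 1` lack some of these terms. -/
theorem d_comp_d (r : WithTop ℤ) (m : ℤ) : d A r m ∘ₗ d A r (m + 1) = 0 := by
  refine LinearMap.ext fun c => funext ?_
  rintro ⟨⟨k, q⟩, h, hr⟩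
  rw [LinearMap.comp_apply, LinearMap.zero_apply, Pi.zero_apply]
  simp only at h hr
  match k, h with
  -- Nothing reaches `CC₀` through `B`: what remains is `b²` and the `bB` that starts from `CC₀`.
  | 0, h =>
    rw [d_zero_apply r m _ q _ ⟨by push_cast at h ⊢; omega, hr⟩,
      d_succ_apply r _ _ _ q _ ⟨by push_cast at h ⊢; omega, hr⟩
        ⟨by push_cast at h ⊢; omega, sub_one_le hr⟩,
      map_add, CC.b_b, CC.b_B_zero, add_zero]
  -- Here `B²` is absent, as it would start in chain degree `-1`.
  | 1, h =>
    rw [d_succ_apply r m _ _ q _ ⟨by push_cast at h ⊢; omega, hr⟩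
        ⟨by push_cast at h ⊢; omega, sub_one_le hr⟩,
      d_succ_apply r _ _ _ q _ ⟨by push_cast at h ⊢; omega, hr⟩
        ⟨by push_cast at h ⊢; omega, sub_one_le hr⟩,
      d_zero_apply r _ _ (q - 1) _ ⟨by push_cast at h ⊢; omega, sub_one_le hr⟩,
      map_add, CC.b_b, add_assoc]
    exact (zero_add _).trans (CC.b_B_add_B_b 0 _)
  | k + 2, h =>
    rw [d_succ_apply r m _ _ q _ ⟨by push_cast at h ⊢; omega, hr⟩
        ⟨by push_cast at h ⊢; omega, sub_one_le hr⟩,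
      d_succ_apply r _ _ _ q _ ⟨by push_cast at h ⊢; omega, hr⟩
        ⟨by push_cast at h ⊢; omega, sub_one_le hr⟩,
      d_succ_apply r _ _ _ (q - 1) _ ⟨by push_cast at h ⊢; omega, sub_one_le hr⟩
        ⟨by push_cast at h ⊢; omega, sub_one_le (sub_one_le hr)⟩,
      map_add, map_add, CC.b_b, CC.B_B, zero_add, add_zero, CC.b_B_add_B_b]

theorem map_comp_d (φ : A →L[ℂ] A') (hφ : ∀ x y, φ (x * y) = φ x * φ y) (r : WithTop ℤ) (m : ℤ) :
    map φ r m ∘ₗ d A r m = d A' r m ∘ₗ map φ r (m + 1) := by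
  refine LinearMap.ext fun c => funext ?_
  rintro ⟨⟨k, q⟩, h, hr⟩
  rw [LinearMap.comp_apply, LinearMap.comp_apply]
  change CC.map φ k (d A r m c ⟨(k, q), h, hr⟩) = _
  simp only at h hr
  match k, h with
  | 0, h =>
    have h₁ : ((1 : ℕ) : ℤ) - 2 * q = m + 1 ∧ (q : WithTop ℤ) ≤ r :=
      ⟨by push_cast at h ⊢; omega, hr⟩
    rw [d_zero_apply r m _ q _ h₁, d_zero_apply r m _ q _ h₁, CC.map_b φ hφ]
    rfl
  | k + 1, h =>
    have h₁ : ((k + 2 : ℕ) : ℤ) - 2 * q = m + 1 ∧ (q : WithTop ℤ) ≤ r :=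
      ⟨by push_cast at h ⊢; omega, hr⟩
    have h₂ : (k : ℤ) - 2 * (q - 1) = m + 1 ∧ ((q - 1 : ℤ) : WithTop ℤ) ≤ r :=
      ⟨by push_cast at h ⊢; omega, sub_one_le hr⟩
    rw [d_succ_apply r m _ k q _ h₁ h₂, d_succ_apply r m _ k q _ h₁ h₂, map_add, CC.map_b φ hφ,
      CC.map_B]
    rfl

end LaurentCC

/-! ### Contraction of an augmented cosimplicial diagram -/

/-- An augmented cosimplicial diagram of complexes with an extra degeneracy `h` is an exact
sequence of complexes. -/
theorem ExactSequenceOfComplexes.of_extraDegeneracy {ι : Type*} {s : ι → ι} {K : ι → Type*}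
    {C : ℕ → ι → Type*} [∀ n, AddCommGroup (K n)] [∀ n, Module ℂ (K n)]
    [∀ p n, AddCommGroup (C p n)] [∀ p n, Module ℂ (C p n)]
    {dK : ∀ n, K (s n) →ₗ[ℂ] K n} {dC : ∀ p n, C p (s n) →ₗ[ℂ] C p n}
    {ε : ∀ n, K n →ₗ[ℂ] C 0 n} {f : ∀ p, Fin (p + 2) → ∀ n, C p n →ₗ[ℂ] C (p + 1) n}
    {δ : ∀ p n, C p n →ₗ[ℂ] C (p + 1) n}
    (hδ : ∀ p n, δ p n = ∑ k : Fin (p + 2), (-1 : ℂ) ^ (k : ℕ) • f p k n)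
    (dK_dK : ∀ n, dK n ∘ₗ dK (s n) = 0) (dC_dC : ∀ p n, dC p n ∘ₗ dC p (s n) = 0)
    (ε_dK : ∀ n, ε n ∘ₗ dK n = dC 0 n ∘ₗ ε (s n))
    (f_dC : ∀ p k n, f p k n ∘ₗ dC p n = dC (p + 1) n ∘ₗ f p k (s n))
    (f_ε : ∀ n, f 0 0 n ∘ₗ ε n = f 0 1 n ∘ₗ ε n)
    (f_f : ∀ p (i j : Fin (p + 2)) n, j ≤ i →
      f (p + 1) j.castSucc n ∘ₗ f p i n = f (p + 1) i.succ n ∘ₗ f p j n)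
    (h₀ : ∀ n, C 0 n →ₗ[ℂ] K n) (h : ∀ p n, C (p + 1) n →ₗ[ℂ] C p n)
    (h₀_ε : ∀ n, h₀ n ∘ₗ ε n = LinearMap.id) (h_f_zero : ∀ p n, h p n ∘ₗ f p 0 n = LinearMap.id)
    (h_f_one : ∀ n, h 0 n ∘ₗ f 0 1 n = ε n ∘ₗ h₀ n)
    (h_f_succ : ∀ p (k : Fin (p + 2)) n, h (p + 1) n ∘ₗ f (p + 1) k.succ n = f p k n ∘ₗ h p n) :
    ExactSequenceOfComplexes s dK dC ε δ := by
  have δ_apply : ∀ p n x, δ p n x = ∑ k : Fin (p + 2), (-1 : ℂ) ^ (k : ℕ) • f p k n x := by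
    intro p n x; simp [hδ]
  have δδ : ∀ p n x, δ (p + 1) n (δ p n x) = 0 := by
    intro p n x
    have hx : δ (p + 1) n (δ p n x) = ∑ i : Fin (p + 2), ∑ j : Fin (p + 3),
        ((-1 : ℂ) ^ (i : ℕ) * (-1 : ℂ) ^ (j : ℕ)) • f (p + 1) j n (f p i n x) := by
      rw [δ_apply p, map_sum]
      simp only [map_smul, δ_apply (p + 1), smul_smul]
      exact Finset.sum_congr rfl fun i _ => Finset.sum_congr rfl fun j _ => by rw [mul_comm]
    rw [hx]
    exact sum_sum_alternating_eq_zero (fun i j => f (p + 1) j n (f p i n x)) fun i j hij =>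
      LinearMap.congr_fun (f_f p i j n hij) x
  -- The contraction at the augmented end: `d₀` yields the identity, and `d₁`, which has sign `-1`,
  -- yields `-εh₀`.
  have hδ_zero : ∀ n x, h 0 n (δ 0 n x) = x - ε n (h₀ n x) := by
    intro n x
    have h1 := LinearMap.congr_fun (h_f_zero 0 n) x
    have h2 := LinearMap.congr_fun (h_f_one n) x
    simp only [LinearMap.comp_apply, LinearMap.id_apply] at h1 h2
    rw [δ_apply, Fin.sum_univ_two]
    simp [h1, h2, sub_eq_add_neg]
  -- The contraction `hδ + δh = id`: moving `h` past `f_{k+1}` lowers the index by one but keeps the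
  -- sign of `k + 1`, so all terms but the first add up to `-δh`.
  have hδ_succ : ∀ p n x, h (p + 1) n (δ (p + 1) n x) = x - δ p n (h p n x) := by
    intro p n x
    have h1 := LinearMap.congr_fun (h_f_zero (p + 1) n) x
    have h2 := fun k => LinearMap.congr_fun (h_f_succ p k n) x
    simp only [LinearMap.comp_apply, LinearMap.id_apply] at h1 h2
    rw [δ_apply, δ_apply, Fin.sum_univ_succ]
    simp [h1, h2, pow_succ, sub_eq_add_neg]
  refine ⟨dK_dK, dC_dC, ε_dK, fun p n => ?_, fun n => ?_, fun n y => ⟨fun hy => ?_, ?_⟩,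
    fun p n y => ⟨fun hy => ?_, ?_⟩⟩
  · refine LinearMap.ext fun x => ?_
    have h1 := fun k => LinearMap.congr_fun (f_dC p k n) x
    simp only [LinearMap.comp_apply] at h1
    simp only [LinearMap.comp_apply, δ_apply, map_sum, map_smul, h1]
  · exact Function.LeftInverse.injective (g := h₀ n) fun x => LinearMap.congr_fun (h₀_ε n) x
  -- For a cocycle the contraction formula exhibits the primitive; the same happens below with `h`.
  · exact ⟨h₀ n y, by
           have := hδ_zero n y
           rw [hy, map_zero] at this
           exact (sub_eq_zero.1 this.symm).symm⟩
  · rintro ⟨x, rfl⟩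
    have := LinearMap.congr_fun (f_ε n) x
    simp only [LinearMap.comp_apply] at this
    rw [δ_apply, Fin.sum_univ_two]
    simp [this]
  · exact ⟨h p n y, by
           have := hδ_succ p n y
           rw [hy, map_zero] at this
           exact (sub_eq_zero.1 this.symm).symm⟩
  · rintro ⟨x, rfl⟩
    exact δδ p n x

/-! ### Cutting off sections by a smooth function and extending by zero -/

section Cutoff

open TopologicalSpace (Opens)

universe v

variable {E H X : Type*} [NormedAddCommGroup E] [NormedSpace ℝ E]
  [NormedAddCommGroup H] [InnerProductSpace ℂ H] [CompleteSpace H]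
  [TopologicalSpace X] [ChartedSpace E X]
  {P : PrincipalPUBundle.{v} E H X} {V W : Opens X}

namespace PrincipalPUBundle

open Classical in
/-- The product of a function on `X` with a section over `W`, extended by zero to `V`. -/
def mulExtend (ρ : X → ℝ) (s : P.Over W → TraceClass H) (p : P.Over V) : TraceClass H :=
  if h : P.proj p.1 ∈ W then (ρ (P.proj p.1) : ℂ) • s ⟨p.1, h⟩ else 0

theorem localRep_mulExtend (ρ : X → ℝ) (s : P.Over W → TraceClass H) (i : P.Index) {x : X}
    (hx : x ∈ V ⊓ P.base i) :
    localRep (mulExtend ρ s : P.Over V → TraceClass H) i x = ρ x • localRep s i x := by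
  have hp : P.proj (P.sec i x) = x := P.proj_sec i x hx.2
  have hV : P.proj (P.sec i x) ∈ V := by rw [hp]; exact hx.1
  rw [localRep, dif_pos hV, mulExtend, localRep]
  split_ifs with h
  · rw [Complex.coe_smul]
    exact congrArg (fun z => ρ z • s ⟨P.sec i x, h⟩) hp
  · rw [smul_zero]

/-- The weight is pulled back from the base, hence constant along orbits, and `Ad` is linear. -/
theorem mulExtend_act (ρ : X → ℝ) (s : P.Over W → TraceClass H)
    (hs : ∀ p g, s (p.act g) = Ad g⁻¹ (s p)) (p : P.Over V) (g : PU H) :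
    mulExtend ρ s (p.act g) = Ad g⁻¹ (mulExtend ρ s p) := by
  have hp : P.proj (p.act g).1 = P.proj p.1 := P.proj_smul g p.1
  simp only [mulExtend]
  by_cases h : P.proj p.1 ∈ W
  · rw [dif_pos h, dif_pos (hp ▸ h), map_smul, ← hs ⟨p.1, h⟩]
    exact congrArg (fun z => (ρ z : ℂ) • s (Over.act ⟨p.1, h⟩ g)) hp
  · rw [dif_neg h, dif_neg (hp ▸ h), map_zero]

/-- Smoothness is local on `V`: at a point of `tsupport ρ`, which then lies in `W`, the section is a
product of smooth maps; elsewhere it vanishes in a neighbourhood. -/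
theorem smoothSection_mulExtend {ρ : X → ℝ} (hρ : ContMDiff 𝓘(ℝ, E) 𝓘(ℝ) ∞ ρ)
    (hVW : ∀ x ∈ V, x ∈ tsupport ρ → x ∈ W) {s : P.Over W → TraceClass H} (hs : SmoothSection s) :
    SmoothSection (mulExtend ρ s : P.Over V → TraceClass H) := by
  intro i x hx
  refine ContMDiffAt.contMDiffWithinAt ?_
  have heq : localRep (mulExtend ρ s : P.Over V → TraceClass H) i =ᶠ[𝓝 x]
      fun z => ρ z • localRep s i z := by
    filter_upwards [(V ⊓ P.base i).isOpen.mem_nhds hx] with z hz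
    exact localRep_mulExtend ρ s i hz
  by_cases hx' : x ∈ tsupport ρ
  · have hxW : x ∈ W ⊓ P.base i := ⟨hVW x hx.1 hx', hx.2⟩
    refine ContMDiffAt.congr_of_eventuallyEq ?_ heq
    exact hρ.contMDiffAt.smul ((hs i).contMDiffAt ((W ⊓ P.base i).isOpen.mem_nhds hxW))
  · refine (contMDiffAt_const (c := (0 : TraceClass H))).congr_of_eventuallyEq (heq.trans ?_)
    filter_upwards [notMem_tsupport_iff_eventuallyEq.1 hx'] with z hz
    rw [hz, Pi.zero_apply, zero_smul]

namespace Sections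

/-- Evaluation of sections. -/
def evalAt (p : P.Over V) : P.Sections V →ₗ[ℂ] TraceClass H where
  toFun s := s.val p
  map_add' _ _ := rfl
  map_smul' _ _ := rfl

theorem val_sum_apply {ι : Type*} (S : Finset ι) (s : ι → P.Sections V) (p : P.Over V) :
    (∑ i ∈ S, s i).val p = ∑ i ∈ S, (s i).val p :=
  map_sum (evalAt p) s S

variable [IsManifold 𝓘(ℝ, E) ∞ X]

theorem exists_bound_iteratedFDeriv {ρ : X → ℝ} (hρ : ContMDiff 𝓘(ℝ, E) 𝓘(ℝ) ∞ ρ)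
    {φ : OpenPartialHomeomorph X E} (hφ : φ ∈ atlas E X) {K : Set E} (hK : IsCompact K)
    (hKφ : K ⊆ φ.target) (n : ℕ) :
    ∃ C : ℝ, 0 ≤ C ∧ ∀ y ∈ K, ‖iteratedFDeriv ℝ n (ρ ∘ φ.symm) y‖ ≤ C := by
  have h : ContDiffOn ℝ ∞ (ρ ∘ φ.symm) φ.target := by
    rw [← contMDiffOn_iff_contDiffOn]
    exact hρ.comp_contMDiffOn (contMDiffOn_symm_of_mem_maximalAtlas
      (IsManifold.subset_maximalAtlas hφ))
  have h2 : ContinuousOn (iteratedFDeriv ℝ n (ρ ∘ φ.symm)) K :=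
    ((h.continuousOn_iteratedFDerivWithin (m := n) (by exact_mod_cast le_top)
      φ.open_target.uniqueDiffOn).congr fun y hy =>
        (iteratedFDerivWithin_of_isOpen n φ.open_target hy).symm).mono hKφ
  obtain ⟨C, hC⟩ := hK.exists_bound_of_continuousOn h2
  exact ⟨max C 0, le_max_right _ _, fun y hy => (hC y hy).trans (le_max_left _ _)⟩

/-- The part of the compact set of a jet index over the support of `ρ`. -/
def JetIndex.inter (a : JetIndex P V) (ρ : X → ℝ) (hVW : ∀ x ∈ V, x ∈ tsupport ρ → x ∈ W)
    (n : ℕ) : JetIndex P W where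
  i := a.i
  φ := a.φ
  mem_atlas := a.mem_atlas
  K := ⟨a.K ∩ a.φ.symm ⁻¹' tsupport ρ, by
    have hc : ContinuousOn a.φ.symm a.K :=
      a.φ.continuousOn_symm.mono fun y hy => (a.subset hy).1
    exact a.K.isCompact.of_isClosed_subset
      (hc.preimage_isClosed_of_isClosed a.K.isCompact.isClosed (isClosed_tsupport ρ))
      Set.inter_subset_left⟩
  subset := fun _ hy => ⟨(a.subset hy.1).1, hVW _ (a.subset hy.1).2.1 hy.2, (a.subset hy.1).2.2⟩
  order := n

variable (P) in
/-- The linear map underlying `cutoff`. -/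
def cutoffLinear {ρ : X → ℝ} (hρ : ContMDiff 𝓘(ℝ, E) 𝓘(ℝ) ∞ ρ)
    (hVW : ∀ x ∈ V, x ∈ tsupport ρ → x ∈ W) : P.Sections W →ₗ[ℂ] P.Sections V where
  toFun s := ⟨mulExtend ρ s.val, mulExtend_act ρ s.val s.property.1,
    smoothSection_mulExtend hρ hVW s.smooth⟩
  map_add' s t := val_injective <| funext fun p => by
    change mulExtend ρ (s + t).val p = mulExtend ρ s.val p + mulExtend ρ t.val p
    simp only [mulExtend, val_add]
    split_ifs <;> simp
  map_smul' c s := val_injective <| funext fun p => by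
    change mulExtend ρ (c • s).val p = c • mulExtend ρ s.val p
    simp only [mulExtend, val_smul]
    split_ifs with h
    · exact smul_comm (ρ (P.proj p.1) : ℂ) c (s.val ⟨p.1, h⟩)
    · simp

/-- The Leibniz rule bounds the derivatives of `ρ s` by those of `s`. The compact set of `a` need
not lie over `W`, but its part over `tsupport ρ` does, is still compact, and is all that matters. -/
theorem exists_jetSeminorm_cutoffLinear_le {ρ : X → ℝ} (hρ : ContMDiff 𝓘(ℝ, E) 𝓘(ℝ) ∞ ρ)
    (hVW : ∀ x ∈ V, x ∈ tsupport ρ → x ∈ W) (a : JetIndex P V) :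
    ∃ C : ℕ → ℝ, ∀ s : P.Sections W, jetSeminorm a (cutoffLinear P hρ hVW s) ≤
      ∑ k ∈ Finset.range (a.order + 1),
        C k * jetSeminorm (a.inter ρ hVW (a.order - k)) s := by
  -- `C k` bounds the `k`-th derivative of `ρ` on the whole compact set of `a`.
  choose C hC0 hC using exists_bound_iteratedFDeriv hρ a.mem_atlas a.K.isCompact
    fun y hy => (a.subset hy).1
  have hnonneg : ∀ (s : P.Sections W), 0 ≤ ∑ k ∈ Finset.range (a.order + 1),
      (a.order.choose k * C k) * jetSeminorm (a.inter ρ hVW (a.order - k)) s := fun s =>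
    Finset.sum_nonneg fun k _ =>
      mul_nonneg (mul_nonneg (Nat.cast_nonneg _) (hC0 k)) (apply_nonneg _ _)
  refine ⟨fun k => a.order.choose k * C k, fun s => Real.iSup_le (fun y => ?_) (hnonneg s)⟩
  obtain ⟨y, hy⟩ := y
  have hyV := a.subset hy
  have heq : chartRep (cutoffLinear P hρ hVW s) a.i a.φ =ᶠ[𝓝 y]
      fun z => (ρ ∘ a.φ.symm) z • chartRep s a.i a.φ z := by
    filter_upwards [(isOpen_chartDomain a.i a.φ).mem_nhds hyV] with z hz
    exact localRep_mulExtend ρ s.val a.i hz.2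
  by_cases hyρ : a.φ.symm y ∈ tsupport ρ
  · have hyW : y ∈ chartDomain P W a.i a.φ := ⟨hyV.1, hVW _ hyV.2.1 hyρ, hyV.2.2⟩
    have ho := isOpen_chartDomain (P := P) (U := W) a.i a.φ
    have hρ' : ContDiffOn ℝ ∞ (ρ ∘ a.φ.symm) (chartDomain P W a.i a.φ) := by
      rw [← contMDiffOn_iff_contDiffOn]
      exact hρ.comp_contMDiffOn ((contMDiffOn_symm_of_mem_maximalAtlas
        (IsManifold.subset_maximalAtlas a.mem_atlas)).mono Set.inter_subset_left)
    have h := norm_iteratedFDerivWithin_smul_le hρ' (contDiffOn_chartRep s a.i a.mem_atlas)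
      ho.uniqueDiffOn hyW (n := a.order) (by exact_mod_cast le_top)
    rw [iteratedFDerivWithin_of_isOpen _ ho hyW] at h
    rw [(heq.iteratedFDeriv ℝ a.order).eq_of_nhds]
    refine h.trans (Finset.sum_le_sum fun k _ => ?_)
    rw [iteratedFDerivWithin_of_isOpen _ ho hyW, iteratedFDerivWithin_of_isOpen _ ho hyW]
    refine mul_le_mul (mul_le_mul_of_nonneg_left (hC k y hy) (Nat.cast_nonneg _)) ?_
      (norm_nonneg _) (mul_nonneg (Nat.cast_nonneg _) (hC0 k))
    · exact le_jetSeminorm (a.inter ρ hVW (a.order - k)) s ⟨hy, hyρ⟩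
  -- Off the closed support the representative is zero near `y`, not merely at `y`, so its
  -- derivatives vanish too.
  · have hzero : chartRep (cutoffLinear P hρ hVW s) a.i a.φ =ᶠ[𝓝 y]
        fun _ => (0 : TraceClass H) := by
      refine heq.trans ?_
      filter_upwards [(a.φ.continuousAt_symm hyV.1).eventually
        (notMem_tsupport_iff_eventuallyEq.1 hyρ)] with z hz
      rw [Function.comp_apply, hz, Pi.zero_apply, zero_smul]
    rw [(hzero.iteratedFDeriv ℝ a.order).eq_of_nhds]
    simpa using hnonneg s

variable (P) in
/-- Multiplication of sections over `W` by a smooth function `ρ`, followed by extension by zero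
to an open set `V` in which the support of `ρ` is contained in `W`. -/
def cutoff {ρ : X → ℝ} (hρ : ContMDiff 𝓘(ℝ, E) 𝓘(ℝ) ∞ ρ)
    (hVW : ∀ x ∈ V, x ∈ tsupport ρ → x ∈ W) : P.Sections W →L[ℂ] P.Sections V :=
  { cutoffLinear P hρ hVW with
    cont := by
      refine continuous_of_continuousAt_zero (cutoffLinear P hρ hVW) ?_
      refine (withSeminorms.tendsto_nhds _ _).2 fun a ε hε => ?_
      obtain ⟨C, hC⟩ := exists_jetSeminorm_cutoffLinear_le hρ hVW a
      have hc : Continuous fun s : P.Sections W => ∑ k ∈ Finset.range (a.order + 1),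
          C k * jetFamily P W (a.inter ρ hVW (a.order - k)) s :=
        continuous_finsetSum _ fun k _ =>
          continuous_const.mul (withSeminorms.continuous_seminorm _)
      have hz := hc.tendsto 0
      simp only [map_zero, mul_zero, Finset.sum_const_zero] at hz
      filter_upwards [hz.eventually (gt_mem_nhds hε)] with s hs
      rw [map_zero, sub_zero]
      exact (hC s).trans_lt hs }

theorem cutoff_apply {ρ : X → ℝ} (hρ : ContMDiff 𝓘(ℝ, E) 𝓘(ℝ) ∞ ρ)
    (hVW : ∀ x ∈ V, x ∈ tsupport ρ → x ∈ W) (s : P.Sections W) (p : P.Over V) :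
    (cutoff P hρ hVW s).val p = mulExtend ρ s.val p := rfl

/-- The value `t` may be prescribed at every point of `V`: where `s` is undefined, `ρ` vanishes. So
the terms `ρ_i t` can be summed over `i` without asking which `U i` contain the point. -/
theorem cutoff_apply_eq_smul {ρ : X → ℝ} (hρ : ContMDiff 𝓘(ℝ, E) 𝓘(ℝ) ∞ ρ)
    (hVW : ∀ x ∈ V, x ∈ tsupport ρ → x ∈ W) (s : P.Sections W) (p : P.Over V) (t : TraceClass H)
    (h : ∀ hp : P.proj p.1 ∈ W, s.val ⟨p.1, hp⟩ = t) :
    (cutoff P hρ hVW s).val p = (ρ (P.proj p.1) : ℂ) • t := by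
  rw [cutoff_apply, mulExtend]
  split_ifs with hp
  · rw [h hp]
  · rw [image_eq_zero_of_notMem_tsupport fun hx => hp (hVW _ p.2 hx), Complex.ofReal_zero, zero_smul]

/-- This compares cutoffs with different domains and targets, as they occur on the two sides of `h
d_{k+1} = d_k h`. On `tsupport ρ` both sections are defined; elsewhere both products are zero. -/
theorem cutoff_apply_congr {V' W' : Opens X} {ρ : X → ℝ} (hρ : ContMDiff 𝓘(ℝ, E) 𝓘(ℝ) ∞ ρ)
    (hVW : ∀ x ∈ V, x ∈ tsupport ρ → x ∈ W) (hVW' : ∀ x ∈ V', x ∈ tsupport ρ → x ∈ W')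
    (s : P.Sections W) (s' : P.Sections W') (p : P.Total) (hp : P.proj p ∈ V)
    (hp' : P.proj p ∈ V')
    (h : ∀ (hW : P.proj p ∈ W) (hW' : P.proj p ∈ W'), s.val ⟨p, hW⟩ = s'.val ⟨p, hW'⟩) :
    (cutoff P hρ hVW s).val ⟨p, hp⟩ = (cutoff P hρ hVW' s').val ⟨p, hp'⟩ := by
  by_cases hx : P.proj p ∈ tsupport ρ
  · rw [cutoff_apply_eq_smul hρ hVW s ⟨p, hp⟩ (s.val ⟨p, hVW _ hp hx⟩) fun _ => rfl,
      cutoff_apply_eq_smul hρ hVW' s' ⟨p, hp'⟩ (s'.val ⟨p, hVW' _ hp' hx⟩) fun _ => rfl, h]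
  · have hz : ρ (P.proj p) = 0 := image_eq_zero_of_notMem_tsupport hx
    simp only [cutoff_apply, mulExtend, hz, Complex.ofReal_zero, zero_smul, dite_eq_ite, ite_self]

end Sections

end PrincipalPUBundle

end Cutoff

/-! ### The extra degeneracy of the Čech diagram of algebras -/

section CechHomotopy

open TopologicalSpace (Opens)
open PrincipalPUBundle

universe v

variable {E H X I : Type*} [NormedAddCommGroup E] [NormedSpace ℝ E]
  [NormedAddCommGroup H] [InnerProductSpace ℂ H] [CompleteSpace H]
  [TopologicalSpace X] [ChartedSpace E X]

/-- Tuples built in different ways are only propositionally equal, so sections indexed by them have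
different types; values at a point of the total space can still be compared. -/
theorem val_congr_index {P : PrincipalPUBundle.{v} E H X} {U : I → Opens X} {n : ℕ}
    (s : ∀ J : Fin n → I, P.Sections (⨅ j, U (J j))) {J J' : Fin n → I} (h : J = J')
    (q : P.Total) (hq : P.proj q ∈ ⨅ j, U (J j)) (hq' : P.proj q ∈ ⨅ j, U (J' j)) :
    (s J).val ⟨q, hq⟩ = (s J').val ⟨q, hq'⟩ := by
  subst h; rfl

variable [IsManifold 𝓘(ℝ, E) ∞ X] (P : PrincipalPUBundle.{v} E H X) (U : I → Opens X)

theorem augmentation_mul (s t : P.Sections ⊤) :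
    augmentation P U (s * t) = augmentation P U s * augmentation P U t := rfl

theorem coface_mul (p : ℕ) (k : Fin (p + 2)) (s t : CechAlgebra P U p) :
    coface P U p k (s * t) = coface P U p k s * coface P U p k t := rfl

theorem coface_apply (p : ℕ) (k : Fin (p + 2)) (s : CechAlgebra P U p) (J : Fin (p + 2) → I)
    (q : P.Over (⨅ j, U (J j))) :
    (coface P U p k s J).val q = (s (J ∘ k.succAbove)).val
      ⟨q.1, le_iInf (fun j => iInf_le (fun j => U (J j)) (k.succAbove j)) q.2⟩ := rfl

theorem augmentation_apply (s : P.Sections ⊤) (J : Fin 1 → I) (q : P.Over (⨅ j, U (J j))) :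
    (augmentation P U s J).val q = s.val ⟨q.1, trivial⟩ := rfl

/-- Both composites enumerate in increasing order the positions other than `j` and `i + 1`; since `j
≤ i`, once `j` is omitted the `i`-th remaining position is `i + 1`. -/
theorem succAbove_comp_succAbove {n : ℕ} {i j : Fin (n + 1)} (hij : j ≤ i) :
    j.castSucc.succAbove ∘ i.succAbove = i.succ.succAbove ∘ j.succAbove := by
  ext k
  obtain ⟨i, hi⟩ := i
  obtain ⟨j, hj⟩ := j
  obtain ⟨k, hk⟩ := k
  simp only [Function.comp_apply, Fin.succAbove, Fin.lt_def, Fin.le_def, Fin.castSucc_mk,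
    Fin.succ_mk] at hij ⊢
  split_ifs <;> simp_all <;> omega

theorem coface_comp_coface (p : ℕ) {i j : Fin (p + 2)} (hij : j ≤ i) :
    coface P U (p + 1) j.castSucc ∘L coface P U p i =
      coface P U (p + 1) i.succ ∘L coface P U p j := by
  ext s J
  refine Sections.val_injective (funext fun q => ?_)
  simp only [ContinuousLinearMap.comp_apply, coface_apply]
  exact val_congr_index s (congrArg (J ∘ ·) (succAbove_comp_succAbove hij)) q.1 _ _

theorem coface_zero_comp_augmentation :
    coface P U 0 0 ∘L augmentation P U = coface P U 0 1 ∘L augmentation P U := by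
  ext s J
  refine Sections.val_injective (funext fun q => ?_)
  simp only [ContinuousLinearMap.comp_apply, coface_apply, augmentation_apply]

variable {U} in
theorem mem_iInf_cons {p : ℕ} {J : Fin p → I} {i : I} {x : X} (hx : x ∈ ⨅ j, U (J j))
    (hi : x ∈ U i) : x ∈ ⨅ j, U ((Fin.cons i J : Fin (p + 1) → I) j) := by
  rw [← SetLike.mem_coe, Opens.coe_iInf, Set.mem_iInter] at hx ⊢
  exact Fin.cases hi hx

variable {U} in
theorem mem_iInf_singleton {i : I} {x : X} (hi : x ∈ U i) :
    x ∈ ⨅ j, U ((Fin.cons i Fin.elim0 : Fin 1 → I) j) :=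
  -- The intersection over the empty tuple is the whole space.
  mem_iInf_cons (by rw [iInf_of_empty]; trivial) hi

variable (ρ : SmoothPartitionOfUnity I 𝓘(ℝ, E) X Set.univ)
  (hρ : ρ.IsSubordinate fun i => (U i : Set X)) (S : Finset I)

/-- The extra degeneracy `(h s)_{i₀ … i_p} = ∑ ρ_i s_{i i₀ … i_p}` of the Čech diagram. -/
def homotopy (p : ℕ) : CechAlgebra P U (p + 1) →L[ℂ] CechAlgebra P U p :=
  ContinuousLinearMap.pi fun J => ∑ i ∈ S,
    -- Subordination gives the support condition: a point of `U_J` in the support of `ρ i` lies in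
    -- `U i`, hence in the domain of `s_{iJ}`.
    Sections.cutoff P (ρ i).contMDiff (fun _ hx hi => mem_iInf_cons hx (hρ i hi)) ∘L
      ContinuousLinearMap.proj (Fin.cons i J : Fin (p + 2) → I)

/-- The extra degeneracy `h s = ∑ ρ_i s_i` in degree zero. -/
def homotopyZero : CechAlgebra P U 0 →L[ℂ] P.Sections ⊤ :=
  ∑ i ∈ S, Sections.cutoff P (ρ i).contMDiff
    (fun _ _ hi => mem_iInf_singleton (hρ i hi)) ∘L
      ContinuousLinearMap.proj (Fin.cons i Fin.elim0 : Fin 1 → I)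

theorem homotopy_apply (p : ℕ) (s : CechAlgebra P U (p + 1)) (J : Fin (p + 1) → I)
    (q : P.Over (⨅ j, U (J j))) :
    (homotopy P U ρ hρ S p s J).val q = ∑ i ∈ S, (Sections.cutoff P (ρ i).contMDiff
      (fun _ hx hi => mem_iInf_cons hx (hρ i hi)) (s (Fin.cons i J : Fin (p + 2) → I))).val q := by
  rw [← Sections.val_sum_apply]
  congr 1
  simp [homotopy]

theorem homotopyZero_apply (s : CechAlgebra P U 0) (q : P.Over ⊤) :
    (homotopyZero P U ρ hρ S s).val q = ∑ i ∈ S, (Sections.cutoff P (ρ i).contMDiff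
      (fun _ _ hi => mem_iInf_singleton (hρ i hi))
        (s (Fin.cons i Fin.elim0 : Fin 1 → I))).val q := by
  rw [← Sections.val_sum_apply]
  congr 1
  simp [homotopyZero]

theorem sum_smul_eq {X I : Type*} {ρ : I → X → ℝ} {S : Finset I} (hS : ∀ x, ∑ i ∈ S, ρ i x = 1)
    (x : X) (t : TraceClass H) : ∑ i ∈ S, (ρ i x : ℂ) • t = t := by
  rw [← Finset.sum_smul, ← Complex.ofReal_sum, hS, Complex.ofReal_one, one_smul]

variable {S} in
theorem homotopyZero_comp_augmentation (hS : ∀ x, ∑ i ∈ S, ρ i x = 1) :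
    homotopyZero P U ρ hρ S ∘L augmentation P U = ContinuousLinearMap.id ℂ _ := by
  ext s
  refine Sections.val_injective (funext fun q => ?_)
  rw [ContinuousLinearMap.comp_apply, homotopyZero_apply]
  refine Eq.trans (Finset.sum_congr rfl fun i _ => ?_) (sum_smul_eq hS (P.proj q.1) (s.val q))
  exact Sections.cutoff_apply_eq_smul _ _ _ _ _ fun _ => rfl

-- `d₀` deletes the very index `i` that `h` has put in front, so every summand is `ρ_i s_J`, and the
-- weights add up to one.
variable {S} in
theorem homotopy_comp_coface_zero (hS : ∀ x, ∑ i ∈ S, ρ i x = 1) (p : ℕ) :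
    homotopy P U ρ hρ S p ∘L coface P U p 0 = ContinuousLinearMap.id ℂ _ := by
  ext s J
  refine Sections.val_injective (funext fun q => ?_)
  rw [ContinuousLinearMap.comp_apply, homotopy_apply]
  refine Eq.trans (Finset.sum_congr rfl fun i _ => ?_) (sum_smul_eq hS (P.proj q.1) ((s J).val q))
  refine Sections.cutoff_apply_eq_smul _ _ _ _ _ fun _ => ?_
  rw [coface_apply]
  exact val_congr_index s (funext fun k => by simp) q.1 _ _

/-- The deleted index is the old one, so both sides are `∑ ρ_i s_i`, restricted; they agree summand
by summand. -/
theorem homotopy_comp_coface_one :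
    homotopy P U ρ hρ S 0 ∘L coface P U 0 1 = augmentation P U ∘L homotopyZero P U ρ hρ S := by
  ext s J
  refine Sections.val_injective (funext fun q => ?_)
  rw [ContinuousLinearMap.comp_apply, homotopy_apply, ContinuousLinearMap.comp_apply,
    augmentation_apply, homotopyZero_apply]
  refine Finset.sum_congr rfl fun i _ => ?_
  refine Sections.cutoff_apply_congr _ _ _ _ _ q.1 _ _ fun _ _ => ?_
  rw [coface_apply]
  exact val_congr_index s (funext fun k => by fin_cases k; rfl) q.1 _ _

/-- Putting `i` in front shifts positions by one: deleting position `k + 1` afterwards is deleting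
position `k` before. The equality holds for each `i` separately. -/
theorem homotopy_comp_coface_succ (p : ℕ) (k : Fin (p + 2)) :
    homotopy P U ρ hρ S (p + 1) ∘L coface P U (p + 1) k.succ =
      coface P U p k ∘L homotopy P U ρ hρ S p := by
  ext s J
  refine Sections.val_injective (funext fun q => ?_)
  rw [ContinuousLinearMap.comp_apply, homotopy_apply, ContinuousLinearMap.comp_apply,
    coface_apply, homotopy_apply]
  refine Finset.sum_congr rfl fun i _ => ?_
  refine Sections.cutoff_apply_congr _ _ _ _ _ q.1 _ _ fun _ _ => ?_
  rw [coface_apply]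
  refine val_congr_index s (funext fun l => ?_) q.1 _ _
  refine Fin.cases ?_ (fun l => ?_) l <;> simp

end CechHomotopy

/-! ### The partition of unity and the three exact sequences -/

section Exactness

open TopologicalSpace (Opens)

universe v

variable {E H X I : Type*} [NormedAddCommGroup E] [NormedSpace ℝ E]
  [NormedAddCommGroup H] [InnerProductSpace ℂ H] [CompleteSpace H]
  [TopologicalSpace X] [ChartedSpace E X] [IsManifold 𝓘(ℝ, E) ∞ X]

/-- On a compact space a locally finite family has only finitely many non-empty members. A single
finite `S` valid at all points makes the extra degeneracy a finite sum of continuous maps. -/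
theorem exists_smoothPartitionOfUnity_finset [FiniteDimensional ℝ E] [T2Space X] [CompactSpace X]
    {U : I → Opens X} (hU : ∀ x, ∃ i, x ∈ U i) :
    ∃ ρ : SmoothPartitionOfUnity I 𝓘(ℝ, E) X Set.univ,
      ρ.IsSubordinate (fun i => (U i : Set X)) ∧ ∃ S : Finset I, ∀ x, ∑ i ∈ S, ρ i x = 1 := by
  obtain ⟨ρ, hρ⟩ := SmoothPartitionOfUnity.exists_isSubordinate 𝓘(ℝ, E) isClosed_univ
    (fun i => (U i : Set X)) (fun i => (U i).isOpen) fun x _ => Set.mem_iUnion.2 (hU x)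
  refine ⟨ρ, hρ, ρ.locallyFinite.finite_nonempty_of_compact.toFinset, fun x => ?_⟩
  rw [← ρ.sum_eq_one (Set.mem_univ x)]
  refine (finsum_eq_sum_of_support_subset _ fun i hi => ?_).symm
  exact Finset.mem_coe.2 ((Set.Finite.mem_toFinset _).2 ⟨x, hi⟩)

variable (P : PrincipalPUBundle.{v} E H X) (U : I → Opens X)
  (ρ : SmoothPartitionOfUnity I 𝓘(ℝ, E) X Set.univ)
  {S : Finset I}

/-- The identities for the extra degeneracy, proved for the algebras, are carried over by
functoriality of `CC`; multiplicativity is invoked only for the augmentation and the cofaces. -/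
theorem exact_hochschild (hρ : ρ.IsSubordinate fun i => (U i : Set X))
    (hS : ∀ x, ∑ i ∈ S, ρ i x = 1) :
    ExactSequenceOfComplexes (fun n : ℕ => n + 1)
      (fun n => CC.b (P.Sections ⊤) n) (fun p n => CC.b (CechAlgebra P U p) n)
      (fun n => CC.map (augmentation P U) n) (fun p n => hochschildDelta P U p n) :=
  .of_extraDegeneracy (f := fun p k n => CC.map (coface P U p k) n)
    (h₀ := fun n => CC.map (homotopyZero P U ρ hρ S) n)
    (h := fun p n => CC.map (homotopy P U ρ hρ S p) n)
    (hδ := fun _ _ => rfl)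
    (dK_dK := fun n => LinearMap.ext (CC.b_b n))
    (dC_dC := fun _ n => LinearMap.ext (CC.b_b n))
    (ε_dK := fun n => LinearMap.ext (CC.map_b _ (augmentation_mul P U) n))
    (f_dC := fun p k n => LinearMap.ext (CC.map_b _ (coface_mul P U p k) n))
    (f_ε := fun n => by rw [← CC.map_comp, ← CC.map_comp, coface_zero_comp_augmentation])
    (f_f := fun p i j n hij => by rw [← CC.map_comp, ← CC.map_comp, coface_comp_coface P U p hij])
    (h₀_ε := fun n => by rw [← CC.map_comp, homotopyZero_comp_augmentation P U ρ hρ hS, CC.map_id])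
    (h_f_zero := fun p n => by
      rw [← CC.map_comp, homotopy_comp_coface_zero P U ρ hρ hS, CC.map_id])
    (h_f_one := fun n => by rw [← CC.map_comp, ← CC.map_comp, homotopy_comp_coface_one])
    (h_f_succ := fun p k n => by rw [← CC.map_comp, ← CC.map_comp, homotopy_comp_coface_succ])

/-- Induced maps act coefficient by coefficient, so the argument is that of the Hochschild case,
uniformly in the truncation `r`. -/
theorem exact_laurent (hρ : ρ.IsSubordinate fun i => (U i : Set X))
    (hS : ∀ x, ∑ i ∈ S, ρ i x = 1) (r : WithTop ℤ) :
    ExactSequenceOfComplexes (fun m : ℤ => m + 1)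
      (fun m => LaurentCC.d (P.Sections ⊤) r m) (fun p m => LaurentCC.d (CechAlgebra P U p) r m)
      (fun m => LaurentCC.map (augmentation P U) r m) (fun p m => laurentDelta P U r p m) :=
  .of_extraDegeneracy (f := fun p k m => LaurentCC.map (coface P U p k) r m)
    (h₀ := fun m => LaurentCC.map (homotopyZero P U ρ hρ S) r m)
    (h := fun p m => LaurentCC.map (homotopy P U ρ hρ S p) r m)
    (hδ := fun _ _ => rfl)
    (dK_dK := fun m => LaurentCC.d_comp_d r m)
    (dC_dC := fun _ m => LaurentCC.d_comp_d r m)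
    (ε_dK := fun m => LaurentCC.map_comp_d _ (augmentation_mul P U) r m)
    (f_dC := fun p k m => LaurentCC.map_comp_d _ (coface_mul P U p k) r m)
    (f_ε := fun m => by
      rw [← LaurentCC.map_comp, ← LaurentCC.map_comp, coface_zero_comp_augmentation])
    (f_f := fun p i j m hij => by
      rw [← LaurentCC.map_comp, ← LaurentCC.map_comp, coface_comp_coface P U p hij])
    (h₀_ε := fun m => by
      rw [← LaurentCC.map_comp, homotopyZero_comp_augmentation P U ρ hρ hS, LaurentCC.map_id])
    (h_f_zero := fun p m => by
      rw [← LaurentCC.map_comp, homotopy_comp_coface_zero P U ρ hρ hS, LaurentCC.map_id])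
    (h_f_one := fun m => by
      rw [← LaurentCC.map_comp, ← LaurentCC.map_comp, homotopy_comp_coface_one])
    (h_f_succ := fun p k m => by
      rw [← LaurentCC.map_comp, ← LaurentCC.map_comp, homotopy_comp_coface_succ])

end Exactness

end CechCyclic

end

theorem mainTheorem9 {E H X I : Type*}
    [NormedAddCommGroup E] [NormedSpace ℝ E] [FiniteDimensional ℝ E]
    [NormedAddCommGroup H] [InnerProductSpace ℂ H] [CompleteSpace H]
    [TopologicalSpace X] [T2Space X] [CompactSpace X]
    [ChartedSpace E X] [IsManifold 𝓘(ℝ, E) ∞ X]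
    (P : PrincipalPUBundle E H X)
    (U : I → TopologicalSpace.Opens X) (hU : IsGoodCover U) :
    -- the Hochschild complexes
    ExactSequenceOfComplexes (fun n : ℕ => n + 1)
      (fun n => CC.b (P.Sections ⊤) n)
      (fun p n => CC.b (CechAlgebra P U p) n)
      (fun n => CC.map (augmentation P U) n)
      (fun p n => hochschildDelta P U p n) ∧
    -- the cyclic complexes
    ExactSequenceOfComplexes (fun m : ℤ => m + 1)
      (fun m => LaurentCC.d (P.Sections ⊤) 0 m)
      (fun p m => LaurentCC.d (CechAlgebra P U p) 0 m)
      (fun m => LaurentCC.map (augmentation P U) 0 m)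
      (fun p m => laurentDelta P U 0 p m) ∧
    -- the periodic cyclic complexes
    ExactSequenceOfComplexes (fun m : ℤ => m + 1)
      (fun m => LaurentCC.d (P.Sections ⊤) ⊤ m)
      (fun p m => LaurentCC.d (CechAlgebra P U p) ⊤ m)
      (fun m => LaurentCC.map (augmentation P U) ⊤ m)
      (fun p m => laurentDelta P U ⊤ p m) := by
  obtain ⟨ρ, hρ, S, hS⟩ := exists_smoothPartitionOfUnity_finset (E := E) hU.cover
  exact ⟨exact_hochschild P U ρ hρ hS, exact_laurent P U ρ hρ hS 0, exact_laurent P U ρ hρ hS ⊤⟩
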